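/- Let $M_0=\partial([0,1]^2)$. A \emph{square metric space} is a metric space $X$ with all distances at most $2$, together with an injective map $S_X\colon M_0\to X$ such that (sq$_1$) $d_X(S_X(i,r),S_X(i,s))=|s-r|=d_X(S_X(r,i),S_X(s,i))$ for $i\in\{0,1\}$, $r,s\in[0,1]$, and (sq$_2$) $d_X(S_X(r,s),S_X(t,u))\ge |r-t|+|s-u|$ for $(r,s),(t,u)\in M_0$. Let $\mathsf{SquaMS}$ be the category of square metric spaces, whose morphisms are the short (non-expanding) maps $f$ with $f\circ S_X=S_Y$. Its initial object is $M_0$ with the path metric (shortest distance along the boundary of the square) and $S=\mathrm{id}$. Let $N=\{0,1,2\}^2$ and $M=N\setminus\{(1,1)\}$. For $I\in\{M,N\}$ let $I\otimes X=(I\times X)/{\sim}$, where $\sim$ is the equivalence relation generated by $((i,j),S_X(1,r))\sim((i+1,j),S_X(0,r))$ and $((i,j),S_X(r,1))\sim((i,j+1),S_X(r,0))$, $r\in[0,1]$, whenever both cells belong to $I$; write $m\otimes x$ for the class of $(m,x)$. The distance of two points of $I\otimes X$ is the infimum, over all finite paths in $I\times X$ between representatives, of the sum of the contributions of consecutive points,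 where a pair related by $\sim$ contributes $0$, any other pair $(m,x),(m,y)$ contributes $\frac13 d_X(x,y)$, and any other pair $(m,x),(n,y)$ with $m\ne n$ contributes $2$. The map $S_{I\otimes X}$ sends a point $p$ of $M_0$ to $(i,j)\otimes S_X(3p-(i,j))$, where $(i,j)\in M$ is any cell with $p\in\frac13((i,j)+[0,1]^2)$, so that each side of the new square consists of three copies of the corresponding side of $X$. With $I\otimes f\colon m\otimes x\mapsto m\otimes f(x)$ this defines endofunctors $M\otimes-$ and $N\otimes-$ of $\mathsf{SquaMS}$. \textbf{Theorem.} The category $\mathsf{SquaMS}$ has colimits of all $\omega$-chains, and both functors $M\otimes-$ and $N\otimes-$ preserve them: if $(C,(c_k)_k)$ is a colimit of a chain $A_0\to A_1\to\cdots$, then $(I\otimes C,(I\otimes c_k)_k)$ is a colimit of $I\otimes A_0\to I\otimes A_1\to\cdots$. Consequently, let $F$ be either of the two functors, let $!\colon M_0\to F M_0$ be the unique morphism, and let $(G,(g_k)_k)$ be a colimit of the initial chain \[ M_0\xrightarrow{\;!\;}FM_0\xrightarrow{F!}F^2M_0\xrightarrow{F^2!}\cdots . \] There is a unique morphism $\eta\colon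 FG\to G$ with $\eta\circ Fg_k=g_{k+1}$ for all $k$; the pair $(G,\eta)$ is an initial $F$-algebra, and $\eta$ is an isomorphism of $\mathsf{SquaMS}$ and an isometry. For $F=M\otimes-$ this yields an initial algebra $(G,\eta\colon M\otimes G\to G)$, and for $F=N\otimes-$ an initial algebra $(W,\lambda\colon N\otimes W\to W)$. The canonical maps $g_k\colon M^k\otimes M_0\to G$ are injective, and so are the corresponding maps $N^k\otimes M_0\to W$. -/

import Mathlib

universe u

open CategoryTheory CategoryTheory.Limits

namespace SquareMetric

noncomputable section

/-! ## The boundary of the unit square -/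

/-- The boundary of the unit square `[0,1]²`. -/
def M0 : Set (ℝ × ℝ) :=
  {p | ((p.1 = 0 ∨ p.1 = 1) ∧ p.2 ∈ Set.Icc (0 : ℝ) 1) ∨
       (p.1 ∈ Set.Icc (0 : ℝ) 1 ∧ (p.2 = 0 ∨ p.2 = 1))}

theorem M0_bounds (p : M0) : 0 ≤ p.1.1 ∧ p.1.1 ≤ 1 ∧ 0 ≤ p.1.2 ∧ p.1.2 ≤ 1 := by
  obtain ⟨⟨r, s⟩, h⟩ := p
  simp only [M0, Set.mem_ofPred_eq, Set.mem_Icc] at h ⊢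
  rcases h with ⟨h | h, h1, h2⟩ | ⟨⟨h1, h2⟩, h | h⟩ <;> subst h <;> norm_num [h1, h2]

theorem M0_sides (p : M0) : p.1.1 = 0 ∨ p.1.1 = 1 ∨ p.1.2 = 0 ∨ p.1.2 = 1 := by
  rcases p.2 with ⟨h | h, _⟩ | ⟨_, h | h⟩ <;> simp [h]

theorem M0_mk {r s : ℝ} (hr0 : 0 ≤ r) (hr1 : r ≤ 1) (hs0 : 0 ≤ s) (hs1 : s ≤ 1)
    (h : r = 0 ∨ r = 1 ∨ s = 0 ∨ s = 1) : (r, s) ∈ M0 := by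
  simp only [M0, Set.mem_ofPred_eq, Set.mem_Icc]
  tauto

/-! ## The category of square metric spaces -/

/-- A square metric space: a metric space bounded by `2` with an injective map `S` from the
boundary of the unit square such that distances along each side are those of the unit interval
and distances on the boundary dominate the taxicab distance. -/
structure SquaMS : Type (u + 1) where
  carrier : Type u
  [metric : MetricSpace carrier]
  S : M0 → carrier
  S_injective : Function.Injective S
  dist_le_two : ∀ x y : carrier, dist x y ≤ 2
  /-- distances along the sides `{0} × [0,1]` and `{1} × [0,1]` -/
  sq1_vertical : ∀ p q : M0, (p.1.1 = 0 ∨ p.1.1 = 1) → p.1.1 = q.1.1 →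
    dist (S p) (S q) = |q.1.2 - p.1.2|
  /-- distances along the sides `[0,1] × {0}` and `[0,1] × {1}` -/
  sq1_horizontal : ∀ p q : M0, (p.1.2 = 0 ∨ p.1.2 = 1) → p.1.2 = q.1.2 →
    dist (S p) (S q) = |q.1.1 - p.1.1|
  sq2 : ∀ p q : M0, |p.1.1 - q.1.1| + |p.1.2 - q.1.2| ≤ dist (S p) (S q)

attribute [instance] SquaMS.metric

/-- Morphisms of square metric spaces: short maps which preserve `S`. -/
structure SquaMS.Hom (X Y : SquaMS.{u}) where
  toFun : X.carrier → Y.carrier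
  short : ∀ x y, dist (toFun x) (toFun y) ≤ dist x y
  map_S : ∀ p, toFun (X.S p) = Y.S p

theorem SquaMS.Hom.ext' {X Y : SquaMS.{u}} {f g : SquaMS.Hom X Y}
    (h : ∀ x, f.toFun x = g.toFun x) : f = g := by
  cases f; cases g; congr; exact funext h

instance : Category SquaMS.{u} where
  Hom := SquaMS.Hom
  id X := ⟨fun x => x, fun _ _ => le_rfl, fun _ => rfl⟩
  comp f g := ⟨fun x => g.toFun (f.toFun x), fun x y => (g.short _ _).trans (f.short x y),
    fun p => by rw [f.map_S, g.map_S]⟩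

/-- The underlying map of a morphism. -/
def SquaMS.map {X Y : SquaMS.{u}} (f : X ⟶ Y) : X.carrier → Y.carrier :=
  SquaMS.Hom.toFun f

/-! ## The boundary with the path metric, as the initial object -/

/-- The path metric on the boundary of the unit square. For points on opposite sides it is the
length of the shorter of the two ways around; points which are on a common side or on adjacent
sides are joined by a monotone path along the boundary, so that it is the taxicab distance. -/
def pathDist (p q : M0) : ℝ :=
  if |p.1.1 - q.1.1| = 1 then 1 + min (p.1.2 + q.1.2) ((1 - p.1.2) + (1 - q.1.2))
  else if |p.1.2 - q.1.2| = 1 then 1 + min (p.1.1 + q.1.1) ((1 - p.1.1) + (1 - q.1.1))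
  else |p.1.1 - q.1.1| + |p.1.2 - q.1.2|

/-- `a` is the arc length parameter of the point `p`, counterclockwise from `(0,0)`. -/
def IsParam (p : M0) (a : ℝ) : Prop :=
  (p.1.2 = 0 ∧ a = p.1.1) ∨ (p.1.1 = 1 ∧ a = 1 + p.1.2) ∨
  (p.1.2 = 1 ∧ a = 3 - p.1.1) ∨ (p.1.1 = 0 ∧ a = 4 - p.1.2)

theorem exists_param (p : M0) : ∃ a, IsParam p a := by
  unfold IsParam
  rcases M0_sides p with h | h | h | h
  · exact ⟨4 - p.1.2, by simp [h]⟩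
  · exact ⟨1 + p.1.2, by simp [h]⟩
  · exact ⟨p.1.1, by simp [h]⟩
  · exact ⟨3 - p.1.1, by simp [h]⟩

theorem pathDist_eq {p q : M0} {a b : ℝ} (ha : IsParam p a) (hb : IsParam q b) :
    pathDist p q = min |a - b| (4 - |a - b|) := by
  obtain ⟨hp1, hp2, hp3, hp4⟩ := M0_bounds p
  obtain ⟨hq1, hq2, hq3, hq4⟩ := M0_bounds q
  obtain ⟨⟨r, s⟩, hp⟩ := p
  obtain ⟨⟨t, v⟩, hq⟩ := q
  unfold IsParam at ha hb
  unfold pathDist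
  dsimp only at *
  rcases ha with ⟨rfl, rfl⟩ | ⟨rfl, rfl⟩ | ⟨rfl, rfl⟩ | ⟨rfl, rfl⟩ <;>
  rcases hb with ⟨rfl, rfl⟩ | ⟨rfl, rfl⟩ | ⟨rfl, rfl⟩ | ⟨rfl, rfl⟩ <;>
  simp only [abs_eq_max_neg] <;>
  grind only [max_def, min_def]

theorem pathDist_triangle (p q t : M0) : pathDist p t ≤ pathDist p q + pathDist q t := by
  obtain ⟨a, ha⟩ := exists_param p
  obtain ⟨b, hb⟩ := exists_param q
  obtain ⟨c, hc⟩ := exists_param t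
  rw [pathDist_eq ha hb, pathDist_eq hb hc, pathDist_eq ha hc]
  have h1 : 0 ≤ a ∧ a ≤ 4 := by have := M0_bounds p; unfold IsParam at ha; grind
  have h2 : 0 ≤ b ∧ b ≤ 4 := by have := M0_bounds q; unfold IsParam at hb; grind
  have h3 : 0 ≤ c ∧ c ≤ 4 := by have := M0_bounds t; unfold IsParam at hc; grind
  simp only [abs_eq_max_neg]
  grind only [max_def, min_def]

theorem taxi_le_pathDist (p q : M0) : |p.1.1 - q.1.1| + |p.1.2 - q.1.2| ≤ pathDist p q := by
  have := M0_bounds p; have := M0_bounds q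
  unfold pathDist
  simp only [abs_eq_max_neg]
  grind only [max_def, min_def]

theorem pathDist_le_two (p q : M0) : pathDist p q ≤ 2 := by
  have := M0_bounds p; have := M0_bounds q
  unfold pathDist
  simp only [abs_eq_max_neg]
  grind only [max_def, min_def]

/-- The set `M0`, as a type without its subspace metric. -/
structure Boundary : Type u where
  pt : M0

instance : MetricSpace Boundary.{u} where
  dist a b := pathDist a.pt b.pt
  dist_self a := by simp [pathDist]
  dist_comm a b := by
    simp only [pathDist, abs_sub_comm a.pt.1.1, abs_sub_comm a.pt.1.2, add_comm a.pt.1.1,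
      add_comm a.pt.1.2, add_comm (1 - a.pt.1.1), add_comm (1 - a.pt.1.2)]
  dist_triangle a b c := pathDist_triangle _ _ _
  eq_of_dist_eq_zero := by
    rintro ⟨p⟩ ⟨q⟩ h
    have h1 := taxi_le_pathDist p q
    have h2 : pathDist p q = 0 := h
    have h3 := abs_nonneg (p.1.1 - q.1.1)
    have h4 := abs_nonneg (p.1.2 - q.1.2)
    congr 1
    apply Subtype.ext
    apply Prod.ext
    · exact sub_eq_zero.1 (abs_eq_zero.1 (by linarith))
    · exact sub_eq_zero.1 (abs_eq_zero.1 (by linarith))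

/-- The boundary of the unit square with the path metric and the identity map. -/
def boundaryObj : SquaMS.{u} where
  carrier := Boundary.{u}
  S p := ⟨p⟩
  S_injective p q h := by injection h
  dist_le_two x y := pathDist_le_two _ _
  sq1_vertical p q h h' := by
    change pathDist p q = _
    have := M0_bounds p; have := M0_bounds q
    unfold pathDist
    simp only [abs_eq_max_neg]
    grind only [max_def, min_def]
  sq1_horizontal p q h h' := by
    change pathDist p q = _
    have := M0_bounds p; have := M0_bounds q
    unfold pathDist
    simp only [abs_eq_max_neg]
    grind only [max_def, min_def]
  sq2 p q := taxi_le_pathDist p q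

theorem dist_S_same (X : SquaMS.{u}) (p q : M0)
    (h : (p.1.1 = q.1.1 ∧ (p.1.1 = 0 ∨ p.1.1 = 1)) ∨ (p.1.2 = q.1.2 ∧ (p.1.2 = 0 ∨ p.1.2 = 1))) :
    dist (X.S p) (X.S q) = |p.1.1 - q.1.1| + |p.1.2 - q.1.2| := by
  rcases h with ⟨h, h'⟩ | ⟨h, h'⟩
  · rw [X.sq1_vertical p q h' h, h, abs_sub_comm]; simp
  · rw [X.sq1_horizontal p q h' h, h, abs_sub_comm]; simp

theorem dist_S_le_pathDist (X : SquaMS.{u}) (p q : M0) : dist (X.S p) (X.S q) ≤ pathDist p q := by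
  have adj : ∀ p q : M0, (p.1.1 = 0 ∨ p.1.1 = 1) → (q.1.2 = 0 ∨ q.1.2 = 1) →
      dist (X.S p) (X.S q) ≤ |p.1.1 - q.1.1| + |p.1.2 - q.1.2| := by
    intro p q hp hq
    have bp := M0_bounds p
    have bq := M0_bounds q
    let c : M0 := ⟨(p.1.1, q.1.2), M0_mk bp.1 bp.2.1 bq.2.2.1 bq.2.2.2 (by tauto)⟩
    have h := dist_triangle (X.S p) (X.S c) (X.S q)
    rw [dist_S_same X p c (Or.inl ⟨rfl, hp⟩), dist_S_same X c q (Or.inr ⟨rfl, hq⟩)] at h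
    simp only [c, sub_self, abs_zero] at h
    linarith
  have corners : ∀ p q c c' : M0, _ := fun p q c c' =>
    dist_triangle4 (X.S p) (X.S c) (X.S c') (X.S q)
  have bp := M0_bounds p
  have bq := M0_bounds q
  have hle := taxi_le_pathDist p q
  by_cases hv : (p.1.1 = 0 ∨ p.1.1 = 1) ∧ (q.1.1 = 0 ∨ q.1.1 = 1)
  · by_cases he : p.1.1 = q.1.1
    · exact (dist_S_same X p q (Or.inl ⟨he, hv.1⟩)).le.trans hle
    · have h1 : |p.1.1 - q.1.1| = 1 := by
        rcases hv with ⟨h | h, h' | h'⟩ <;> simp [h, h'] at he ⊢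
      have way : ∀ f : ℝ, (f = 0 ∨ f = 1) →
          dist (X.S p) (X.S q) ≤ |p.1.2 - f| + 1 + |f - q.1.2| := by
        intro f hf
        have hf' : 0 ≤ f ∧ f ≤ 1 := by rcases hf with rfl | rfl <;> norm_num
        let c : M0 := ⟨(p.1.1, f), M0_mk bp.1 bp.2.1 hf'.1 hf'.2 (by tauto)⟩
        let c' : M0 := ⟨(q.1.1, f), M0_mk bq.1 bq.2.1 hf'.1 hf'.2 (by tauto)⟩
        have h := corners p q c c'
        rw [dist_S_same X p c (Or.inl ⟨rfl, hv.1⟩), dist_S_same X c' q (Or.inl ⟨rfl, hv.2⟩),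
          dist_S_same X c c' (Or.inr ⟨rfl, hf⟩)] at h
        simpa [h1, c, c'] using h
      have w0 := way 0 (Or.inl rfl)
      have w1 := way 1 (Or.inr rfl)
      rw [abs_of_nonneg (by linarith), abs_of_nonpos (by linarith)] at w0
      rw [abs_of_nonpos (by linarith), abs_of_nonneg (by linarith)] at w1
      unfold pathDist
      rw [if_pos h1, ← min_add_add_left]
      exact le_min (by linarith) (by linarith)
  by_cases hh : (p.1.2 = 0 ∨ p.1.2 = 1) ∧ (q.1.2 = 0 ∨ q.1.2 = 1)
  · by_cases he : p.1.2 = q.1.2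
    · exact (dist_S_same X p q (Or.inr ⟨he, hh.1⟩)).le.trans hle
    · have h1 : |p.1.2 - q.1.2| = 1 := by
        rcases hh with ⟨h | h, h' | h'⟩ <;> simp [h, h'] at he ⊢
      have h0 : ¬ |p.1.1 - q.1.1| = 1 := by
        intro h0
        apply hv
        rcases abs_cases (p.1.1 - q.1.1) with ⟨h, _⟩ | ⟨h, _⟩ <;> rw [h] at h0
        · exact ⟨Or.inr (by linarith), Or.inl (by linarith)⟩
        · exact ⟨Or.inl (by linarith), Or.inr (by linarith)⟩
      have way : ∀ f : ℝ, (f = 0 ∨ f = 1) →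
          dist (X.S p) (X.S q) ≤ |p.1.1 - f| + 1 + |f - q.1.1| := by
        intro f hf
        have hf' : 0 ≤ f ∧ f ≤ 1 := by rcases hf with rfl | rfl <;> norm_num
        let c : M0 := ⟨(f, p.1.2), M0_mk hf'.1 hf'.2 bp.2.2.1 bp.2.2.2 (by tauto)⟩
        let c' : M0 := ⟨(f, q.1.2), M0_mk hf'.1 hf'.2 bq.2.2.1 bq.2.2.2 (by tauto)⟩
        have h := corners p q c c'
        rw [dist_S_same X p c (Or.inr ⟨rfl, hh.1⟩), dist_S_same X c' q (Or.inr ⟨rfl, hh.2⟩),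
          dist_S_same X c c' (Or.inl ⟨rfl, hf⟩)] at h
        simpa [h1, c, c'] using h
      have w0 := way 0 (Or.inl rfl)
      have w1 := way 1 (Or.inr rfl)
      rw [abs_of_nonneg (by linarith), abs_of_nonpos (by linarith)] at w0
      rw [abs_of_nonpos (by linarith), abs_of_nonneg (by linarith)] at w1
      unfold pathDist
      rw [if_neg h0, if_pos h1, ← min_add_add_left]
      exact le_min (by linarith) (by linarith)
  have sp := M0_sides p
  have sq := M0_sides q
  by_cases hp : p.1.1 = 0 ∨ p.1.1 = 1
  · exact (adj p q hp (by tauto)).trans hle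
  · refine le_trans ?_ hle
    rw [dist_comm, abs_sub_comm p.1.1, abs_sub_comm p.1.2]
    exact adj q p (by tauto) (by tauto)

/-- The boundary with the path metric is initial: the unique morphism to `X` is `S_X`. -/
def boundaryInitial : IsInitial boundaryObj.{u} :=
  IsInitial.ofUniqueHom
    (fun X => ⟨fun b => X.S b.pt, fun b c => dist_S_le_pathDist X b.pt c.pt, fun _ => rfl⟩)
    (fun _ f => SquaMS.Hom.ext' fun b => SquaMS.Hom.map_S f b.pt)

/-! ## Gluing scaled copies -/

/-- The index set `M`: the cells `(column, row)` of the `3 × 3` grid except the central one. -/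
def idxM : Finset (Fin 3 × Fin 3) := Finset.univ.erase (1, 1)

/-- The index set `N`: all cells of the `3 × 3` grid. -/
def idxN : Finset (Fin 3 × Fin 3) := Finset.univ

/-- The index sets used for gluing, namely `M` and `N`: those which contain `M`. -/
class IsIndexSet (I : Finset (Fin 3 × Fin 3)) : Prop where
  outer : idxM ⊆ I

instance : IsIndexSet idxM := ⟨Finset.Subset.refl _⟩

instance : IsIndexSet idxN := ⟨Finset.subset_univ _⟩

/-- The generating pairs of the equivalence relation on `I × M0`: the right side of a cell is
identified with the left side of the cell to its right, `((i,j),(1,r)) ≈ ((i+1,j),(0,r))`, and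
the top side of a cell with the bottom side of the cell above it,
`((i,j),(r,1)) ≈ ((i,j+1),(r,0))`, whenever both cells belong to `I`. -/
def Edge (I : Finset (Fin 3 × Fin 3)) (a b : I × M0) : Prop :=
  ((b.1.1.1 : ℕ) = (a.1.1.1 : ℕ) + 1 ∧ b.1.1.2 = a.1.1.2 ∧
    a.2.1.1 = 1 ∧ b.2.1.1 = 0 ∧ a.2.1.2 = b.2.1.2) ∨
  (b.1.1.1 = a.1.1.1 ∧ (b.1.1.2 : ℕ) = (a.1.1.2 : ℕ) + 1 ∧
    a.2.1.2 = 1 ∧ b.2.1.2 = 0 ∧ a.2.1.1 = b.2.1.1)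

/-- The relation on `I × X` induced by `Edge` through `S_X`. -/
def Glue (I : Finset (Fin 3 × Fin 3)) (X : SquaMS.{u}) (a b : I × X.carrier) : Prop :=
  ∃ p q : M0, a.2 = X.S p ∧ b.2 = X.S q ∧ Edge I (a.1, p) (b.1, q)

/-- The equivalence relation `∼` on `I × X`: the symmetric, reflexive and transitive closure. -/
def glueSetoid (I : Finset (Fin 3 × Fin 3)) (X : SquaMS.{u}) : Setoid (I × X.carrier) :=
  Relation.EqvGen.setoid (Glue I X)

/-- The set `I ⊗ X = (I × X)/∼`. -/
def Tensor (I : Finset (Fin 3 × Fin 3)) (X : SquaMS.{u}) : Type u :=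
  Quotient (glueSetoid I X)

/-- The element `m ⊗ x`. -/
def Tensor.mk (I : Finset (Fin 3 × Fin 3)) (X : SquaMS.{u}) (a : I × X.carrier) : Tensor I X :=
  Quotient.mk (glueSetoid I X) a

/-- The metric on `I × X`: scaled by `1/3` within a copy, and `2` between different copies. -/
def prodDist (I : Finset (Fin 3 × Fin 3)) (X : SquaMS.{u}) (a b : I × X.carrier) : ℝ :=
  if a.1 = b.1 then (1 / 3) * dist a.2 b.2 else 2

open Classical in
/-- The contribution of a pair of consecutive points of a path: pairs related by `∼` count `0`. -/
def step (I : Finset (Fin 3 × Fin 3)) (X : SquaMS.{u}) (a b : I × X.carrier) : ℝ :=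
  if glueSetoid I X a b then 0 else prodDist I X a b

/-- The score of the finite path `f 0, f 1, …, f n` in `I × X`. -/
def score (I : Finset (Fin 3 × Fin 3)) (X : SquaMS.{u}) (n : ℕ) (f : ℕ → I × X.carrier) : ℝ :=
  ∑ k ∈ Finset.range n, step I X (f k) (f (k + 1))

/-- The scores of all finite paths in `I × X` from a representative of `y` to one of `z`. -/
def scores (I : Finset (Fin 3 × Fin 3)) (X : SquaMS.{u}) (y z : Tensor I X) : Set ℝ :=
  {s | ∃ (n : ℕ) (f : ℕ → I × X.carrier),
    Tensor.mk I X (f 0) = y ∧ Tensor.mk I X (f n) = z ∧ s = score I X n f}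

/-- The quotient metric on `I ⊗ X`. -/
def tensorDist (I : Finset (Fin 3 × Fin 3)) (X : SquaMS.{u}) (y z : Tensor I X) : ℝ :=
  sInf (scores I X y z)

section Metric

variable {I : Finset (Fin 3 × Fin 3)} {X : SquaMS.{u}}

theorem Tensor.mk_eq {a b : I × X.carrier} :
    Tensor.mk I X a = Tensor.mk I X b ↔ glueSetoid I X a b := Quotient.eq

theorem Tensor.exists_mk (y : Tensor I X) : ∃ a, Tensor.mk I X a = y := Quotient.exists_rep y

theorem prodDist_nonneg (a b : I × X.carrier) : 0 ≤ prodDist I X a b := by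
  unfold prodDist; split_ifs <;> positivity

theorem prodDist_le_two (a b : I × X.carrier) : prodDist I X a b ≤ 2 := by
  have := X.dist_le_two a.2 b.2
  unfold prodDist; split_ifs <;> linarith

theorem step_nonneg (a b : I × X.carrier) : 0 ≤ step I X a b := by
  unfold step; split_ifs
  exacts [le_rfl, prodDist_nonneg a b]

theorem step_le (a b : I × X.carrier) : step I X a b ≤ prodDist I X a b := by
  unfold step; split_ifs
  exacts [prodDist_nonneg a b, le_rfl]

theorem step_comm (a b : I × X.carrier) : step I X a b = step I X b a := by
  have h : glueSetoid I X a b ↔ glueSetoid I X b a :=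
    ⟨(glueSetoid I X).symm, (glueSetoid I X).symm⟩
  have h' : prodDist I X a b = prodDist I X b a := by
    unfold prodDist
    simp only [eq_comm (a := a.1), dist_comm a.2]
  unfold step
  by_cases hab : glueSetoid I X a b
  · rw [if_pos hab, if_pos (h.1 hab)]
  · rw [if_neg hab, if_neg (fun k => hab (h.2 k)), h']

theorem score_nonneg (n : ℕ) (f : ℕ → I × X.carrier) : 0 ≤ score I X n f :=
  Finset.sum_nonneg fun _ _ => step_nonneg _ _

theorem scores_bddBelow (y z : Tensor I X) : BddBelow (scores I X y z) := by
  refine ⟨0, ?_⟩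
  rintro s ⟨n, f, -, -, rfl⟩
  exact score_nonneg n f

theorem step_mem (a b : I × X.carrier) :
    step I X a b ∈ scores I X (Tensor.mk I X a) (Tensor.mk I X b) :=
  ⟨1, fun k => if k = 0 then a else b, by simp, by simp, by simp [score]⟩

theorem scores_nonempty (y z : Tensor I X) : (scores I X y z).Nonempty := by
  obtain ⟨a, rfl⟩ := y.exists_mk
  obtain ⟨b, rfl⟩ := z.exists_mk
  exact ⟨_, step_mem a b⟩

theorem tensorDist_le {y z : Tensor I X} {s : ℝ} (h : s ∈ scores I X y z) :
    tensorDist I X y z ≤ s := csInf_le (scores_bddBelow y z) h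

theorem tensorDist_nonneg (y z : Tensor I X) : 0 ≤ tensorDist I X y z := by
  apply Real.sInf_nonneg
  rintro s ⟨n, f, -, -, rfl⟩
  exact score_nonneg n f

theorem tensorDist_mk_le (a b : I × X.carrier) :
    tensorDist I X (Tensor.mk I X a) (Tensor.mk I X b) ≤ prodDist I X a b :=
  (tensorDist_le (step_mem a b)).trans (step_le a b)

theorem tensorDist_self (y : Tensor I X) : tensorDist I X y y = 0 := by
  obtain ⟨a, rfl⟩ := y.exists_mk
  refine le_antisymm ?_ (tensorDist_nonneg _ _)
  exact tensorDist_le ⟨0, fun _ => a, rfl, rfl, by simp [score]⟩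

theorem scores_comm {y z : Tensor I X} {s : ℝ} (h : s ∈ scores I X y z) :
    s ∈ scores I X z y := by
  obtain ⟨n, f, h0, hn, rfl⟩ := h
  refine ⟨n, fun k => f (n - k), by simpa using hn, by simpa using h0, ?_⟩
  unfold score
  rw [← Finset.sum_range_reflect]
  refine Finset.sum_congr rfl fun k hk => ?_
  have hk := Finset.mem_range.1 hk
  rw [step_comm]
  congr 2 <;> omega

theorem tensorDist_comm (y z : Tensor I X) : tensorDist I X y z = tensorDist I X z y := by
  unfold tensorDist
  congr 1
  ext s
  exact ⟨scores_comm, scores_comm⟩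

theorem scores_add {x y z : Tensor I X} {s t : ℝ} (hs : s ∈ scores I X x y)
    (ht : t ∈ scores I X y z) : s + t ∈ scores I X x z := by
  obtain ⟨n, f, h0, hn, rfl⟩ := hs
  obtain ⟨m, g, g0, gm, rfl⟩ := ht
  refine ⟨(n + 1) + m, fun k => if k ≤ n then f k else g (k - (n + 1)), by simpa using h0, ?_, ?_⟩
  · have : ¬ (n + 1 + m ≤ n) := by omega
    simpa [this] using gm
  · unfold score
    rw [Finset.sum_range_add, Finset.sum_range_succ]
    have e : step I X (f n) (g 0) = 0 := by
      unfold step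
      rw [if_pos (Tensor.mk_eq.1 (hn.trans g0.symm))]
    congr 1
    · have : ∀ k ∈ Finset.range n, step I X (f k) (f (k + 1)) =
          step I X (if k ≤ n then f k else g (k - (n + 1)))
            (if k + 1 ≤ n then f (k + 1) else g (k + 1 - (n + 1))) := by
        intro k hk
        have hk := Finset.mem_range.1 hk
        rw [if_pos (by omega), if_pos (by omega)]
      rw [Finset.sum_congr rfl this]
      simp [e]
    · refine Finset.sum_congr rfl fun k _ => ?_
      dsimp only
      rw [if_neg (by omega), if_neg (by omega)]
      congr 2 <;> omega

theorem tensorDist_triangle (x y z : Tensor I X) :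
    tensorDist I X x z ≤ tensorDist I X x y + tensorDist I X y z := by
  refine le_of_forall_pos_lt_add fun ε hε => ?_
  obtain ⟨s, hs, hs'⟩ := exists_lt_of_csInf_lt (scores_nonempty x y)
    (show tensorDist I X x y < tensorDist I X x y + ε / 2 by linarith)
  obtain ⟨t, ht, ht'⟩ := exists_lt_of_csInf_lt (scores_nonempty y z)
    (show tensorDist I X y z < tensorDist I X y z + ε / 2 by linarith)
  have := tensorDist_le (scores_add hs ht)
  linarith

/-- A function which is constant on the classes of `∼`, `1/3`-Lipschitz on each copy and of
oscillation at most `2` bounds the quotient metric from below. -/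
theorem le_tensorDist (h : I × X.carrier → ℝ) (h1 : ∀ a b, Glue I X a b → h a = h b)
    (h2 : ∀ m x y, |h (m, x) - h (m, y)| ≤ 1 / 3 * dist x y) (h3 : ∀ a b, |h a - h b| ≤ 2)
    (a b : I × X.carrier) :
    |h a - h b| ≤ tensorDist I X (Tensor.mk I X a) (Tensor.mk I X b) := by
  have inv : ∀ a b, glueSetoid I X a b → h a = h b := by
    intro a b hab
    induction hab with
    | rel _ _ h => exact h1 _ _ h
    | refl _ => rfl
    | symm _ _ _ ih => exact ih.symm
    | trans _ _ _ _ _ ih ih' => exact ih.trans ih'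
  have hstep : ∀ a b, |h a - h b| ≤ step I X a b := by
    rintro ⟨m, x⟩ ⟨n, y⟩
    unfold step
    split_ifs with hab
    · rw [inv _ _ hab]; simp
    · unfold prodDist
      split_ifs with hmn
      · dsimp only at hmn
        subst hmn
        exact h2 _ _ _
      · exact h3 _ _
  refine le_csInf (scores_nonempty _ _) ?_
  rintro s ⟨n, f, h0, hn, rfl⟩
  rw [← inv _ _ (Tensor.mk_eq.1 h0), ← inv _ _ (Tensor.mk_eq.1 hn)]
  clear hn
  induction n with
  | zero => simp [score]
  | succ n ih =>
    unfold score at ih ⊢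
    rw [Finset.sum_range_succ]
    have := hstep (f n) (f (n + 1))
    have := abs_sub_le (h (f 0)) (h (f n)) (h (f (n + 1)))
    linarith

/-- The position in the `3 × 3` grid of a point of the boundary of a cell. -/
def posX (a : I × M0) : ℝ := ((a.1.1.1 : ℕ) : ℝ) + a.2.1.1

/-- The position in the `3 × 3` grid of a point of the boundary of a cell. -/
def posY (a : I × M0) : ℝ := ((a.1.1.2 : ℕ) : ℝ) + a.2.1.2

theorem Edge.pos {a b : I × M0} (h : Edge I a b) : posX a = posX b ∧ posY a = posY b := by
  unfold posX posY
  rcases h with ⟨h1, h2, h3, h4, h5⟩ | ⟨h1, h2, h3, h4, h5⟩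
  · rw [h1, h2, h3, h4, h5]; push_cast; constructor <;> ring
  · rw [h1, h2, h3, h4, h5]; push_cast; constructor <;> ring

theorem coord_cases {i k : Fin 3} {r t : ℝ} (hr : 0 ≤ r ∧ r ≤ 1) (ht : 0 ≤ t ∧ t ≤ 1)
    (h : ((i : ℕ) : ℝ) + r = ((k : ℕ) : ℝ) + t) :
    (i = k ∧ r = t) ∨ ((k : ℕ) = (i : ℕ) + 1 ∧ r = 1 ∧ t = 0) ∨
      ((i : ℕ) = (k : ℕ) + 1 ∧ r = 0 ∧ t = 1) := by
  rcases lt_trichotomy (i : ℕ) (k : ℕ) with hik | hik | hik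
  · have h1 : ((i : ℕ) : ℝ) + 1 ≤ ((k : ℕ) : ℝ) := by exact_mod_cast hik
    refine Or.inr (Or.inl ⟨?_, by linarith, by linarith⟩)
    have : ((k : ℕ) : ℝ) = ((i : ℕ) : ℝ) + 1 := by linarith
    exact_mod_cast this
  · refine Or.inl ⟨Fin.ext hik, ?_⟩
    rw [hik] at h
    linarith
  · have h1 : ((k : ℕ) : ℝ) + 1 ≤ ((i : ℕ) : ℝ) := by exact_mod_cast hik
    refine Or.inr (Or.inr ⟨?_, by linarith, by linarith⟩)
    have : ((i : ℕ) : ℝ) = ((k : ℕ) : ℝ) + 1 := by linarith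
    exact_mod_cast this

theorem eqvGen_horizontal {a b : I × M0} (hj : a.1.1.2 = b.1.1.2) (hy : a.2.1.2 = b.2.1.2)
    (hx : posX a = posX b) : Relation.EqvGen (Edge I) a b := by
  have ha := M0_bounds a.2
  have hb := M0_bounds b.2
  rcases coord_cases ⟨ha.1, ha.2.1⟩ ⟨hb.1, hb.2.1⟩ hx with ⟨h1, h2⟩ | ⟨h1, h2, h3⟩ | ⟨h1, h2, h3⟩
  · have : a = b := Prod.ext (Subtype.ext (Prod.ext h1 hj)) (Subtype.ext (Prod.ext h2 hy))
    rw [this]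
    exact Relation.EqvGen.refl _
  · exact Relation.EqvGen.rel _ _ (Or.inl ⟨h1, hj.symm, h2, h3, hy⟩)
  · exact Relation.EqvGen.symm _ _ (Relation.EqvGen.rel _ _ (Or.inl ⟨h1, hj, h3, h2, hy.symm⟩))

theorem eqvGen_vertical {a b : I × M0} (hi : a.1.1.1 = b.1.1.1) (hx : a.2.1.1 = b.2.1.1)
    (hy : posY a = posY b) : Relation.EqvGen (Edge I) a b := by
  have ha := M0_bounds a.2
  have hb := M0_bounds b.2
  rcases coord_cases ha.2.2 hb.2.2 hy with ⟨h1, h2⟩ | ⟨h1, h2, h3⟩ | ⟨h1, h2, h3⟩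
  · have : a = b := Prod.ext (Subtype.ext (Prod.ext hi h1)) (Subtype.ext (Prod.ext hx h2))
    rw [this]
    exact Relation.EqvGen.refl _
  · exact Relation.EqvGen.rel _ _ (Or.inr ⟨hi.symm, h1, h2, h3, hx⟩)
  · exact Relation.EqvGen.symm _ _ (Relation.EqvGen.rel _ _ (Or.inr ⟨hi, h1, h3, h2, hx.symm⟩))

theorem mem_of_ne [IsIndexSet I] {c : Fin 3 × Fin 3} (h : c ≠ (1, 1)) : c ∈ I :=
  IsIndexSet.outer (Finset.mem_erase.2 ⟨h, Finset.mem_univ _⟩)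

theorem eqvGen_of_pos [IsIndexSet I] {a b : I × M0} (hx : posX a = posX b)
    (hy : posY a = posY b) : Relation.EqvGen (Edge I) a b := by
  have ha := M0_bounds a.2
  have hb := M0_bounds b.2
  rcases coord_cases ⟨ha.1, ha.2.1⟩ ⟨hb.1, hb.2.1⟩ hx with ⟨h1, h2⟩ | hx'
  · exact eqvGen_vertical h1 h2 hy
  rcases coord_cases ha.2.2 hb.2.2 hy with ⟨h1, h2⟩ | hy'
  · exact eqvGen_horizontal h1 h2 hx
  have ax : a.2.1.1 = 0 ∨ a.2.1.1 = 1 := by tauto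
  have bx : b.2.1.1 = 0 ∨ b.2.1.1 = 1 := by tauto
  have hne : a.1.1.1 ≠ b.1.1.1 := by
    intro h
    rw [h] at hx'
    omega
  by_cases hc : (a.1.1.1, b.1.1.2) = ((1, 1) : Fin 3 × Fin 3)
  · have hc' : (b.1.1.1, a.1.1.2) ≠ ((1, 1) : Fin 3 × Fin 3) := by
      intro h
      apply hne
      rw [(Prod.ext_iff.1 hc).1, (Prod.ext_iff.1 h).1]
    let c : I × M0 := (⟨(b.1.1.1, a.1.1.2), mem_of_ne hc'⟩,
      ⟨(b.2.1.1, a.2.1.2), M0_mk hb.1 hb.2.1 ha.2.2.1 ha.2.2.2 (by tauto)⟩)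
    exact Relation.EqvGen.trans _ c _ (eqvGen_horizontal rfl rfl hx) (eqvGen_vertical rfl rfl hy)
  · let c : I × M0 := (⟨(a.1.1.1, b.1.1.2), mem_of_ne hc⟩,
      ⟨(a.2.1.1, b.2.1.2), M0_mk ha.1 ha.2.1 hb.2.2.1 hb.2.2.2 (by tauto)⟩)
    exact Relation.EqvGen.trans _ c _ (eqvGen_vertical rfl rfl hy) (eqvGen_horizontal rfl rfl hx)

theorem glue_of_eqvGen {a b : I × M0} (h : Relation.EqvGen (Edge I) a b) :
    Tensor.mk I X (a.1, X.S a.2) = Tensor.mk I X (b.1, X.S b.2) := by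
  induction h with
  | rel a b h => exact Tensor.mk_eq.2 (Relation.EqvGen.rel _ _ ⟨a.2, b.2, rfl, rfl, h⟩)
  | refl _ => rfl
  | symm _ _ _ ih => exact ih.symm
  | trans _ _ _ _ _ ih ih' => exact ih.trans ih'

theorem mk_eq_of_pos [IsIndexSet I] {a b : I × M0} (hx : posX a = posX b)
    (hy : posY a = posY b) : Tensor.mk I X (a.1, X.S a.2) = Tensor.mk I X (b.1, X.S b.2) :=
  glue_of_eqvGen (eqvGen_of_pos hx hy)

theorem coord_le_two (i : Fin 3) : 0 ≤ ((i : ℕ) : ℝ) ∧ ((i : ℕ) : ℝ) ≤ 2 := by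
  have : (i : ℕ) ≤ 2 := by omega
  exact ⟨by positivity, by exact_mod_cast this⟩

theorem linear_bound {e e' i j g : ℝ} (he : e = 1 ∨ e = -1) (he' : e' = 1 ∨ e' = -1)
    (hi : 0 ≤ i) (hi' : i ≤ 2) (hj : 0 ≤ j) (hj' : j ≤ 2) (hg : (e + e') / 2 - 1 ≤ g)
    (hg' : g ≤ (e + e') / 2 + 1) : |(e * i + e' * j + g) / 3 - (e + e') / 2| ≤ 1 := by
  rw [abs_le]
  rcases he with rfl | rfl <;> rcases he' with rfl | rfl <;> constructor <;> linarith

theorem linear_le_tensorDist {e e' : ℝ} (he : e = 1 ∨ e = -1) (he' : e' = 1 ∨ e' = -1)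
    (a b : I × M0) :
    |(e * posX a + e' * posY a) / 3 - (e * posX b + e' * posY b) / 3| ≤
      tensorDist I X (Tensor.mk I X (a.1, X.S a.2)) (Tensor.mk I X (b.1, X.S b.2)) := by
  let L : M0 → ℝ := fun p => e * p.1.1 + e' * p.1.2
  have hL : ∀ p q, |L p - L q| ≤ dist (X.S p) (X.S q) := by
    intro p q
    refine le_trans ?_ (X.sq2 p q)
    have : L p - L q = e * (p.1.1 - q.1.1) + e' * (p.1.2 - q.1.2) := by simp only [L]; ring
    rw [this]
    refine (abs_add_le _ _).trans ?_
    rw [abs_mul, abs_mul]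
    rcases he with rfl | rfl <;> rcases he' with rfl | rfl <;> simp
  have : ∃ g : X.carrier → ℝ, (∀ x y, |g x - g y| ≤ dist x y) ∧ ∀ p, g (X.S p) = L p := by
    have : Nonempty M0 := ⟨a.2⟩
    have hinv : ∀ p, Function.invFun X.S (X.S p) = p := Function.leftInverse_invFun X.S_injective
    have hf : LipschitzOnWith 1 (fun x => L (Function.invFun X.S x)) (Set.range X.S) := by
      apply LipschitzOnWith.of_dist_le_mul
      rintro _ ⟨p, rfl⟩ _ ⟨q, rfl⟩
      simpa [hinv, Real.dist_eq] using hL p q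
    obtain ⟨g, hg, hg'⟩ := hf.extend_real
    refine ⟨g, fun x y => by simpa [Real.dist_eq] using hg.dist_le_mul x y, fun p => ?_⟩
    rw [← hg' ⟨p, rfl⟩]
    simp only [hinv]
  obtain ⟨g, hg, hgS⟩ := this
  let c := (e + e') / 2
  let g' : X.carrier → ℝ := fun x => max (c - 1) (min (c + 1) (g x))
  have hg' : ∀ x y, |g' x - g' y| ≤ dist x y := fun x y =>
    (abs_max_sub_max_le_max _ _ _ _).trans (by
      have h1 := abs_min_sub_min_le_max (c + 1) (g x) (c + 1) (g y)
      have h2 := hg x y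
      have h3 : 0 ≤ dist x y := dist_nonneg
      simp only [sub_self, abs_zero] at h1 ⊢
      exact max_le h3 (h1.trans (max_le h3 h2)))
  have hg'S : ∀ p, g' (X.S p) = L p := by
    intro p
    have hp := M0_bounds p
    simp only [g', hgS]
    have h1 : L p ≤ c + 1 := by
      simp only [L, c]
      rcases he with rfl | rfl <;> rcases he' with rfl | rfl <;> linarith
    have h2 : c - 1 ≤ L p := by
      simp only [L, c]
      rcases he with rfl | rfl <;> rcases he' with rfl | rfl <;> linarith
    rw [min_eq_right h1, max_eq_right h2]
  have hg'1 : ∀ x, c - 1 ≤ g' x := fun x => le_max_left _ _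
  have hg'2 : ∀ x, g' x ≤ c + 1 := fun x => max_le (by linarith) (min_le_left _ _)
  let h : I × X.carrier → ℝ := fun z =>
    (e * ((z.1.1.1 : ℕ) : ℝ) + e' * ((z.1.1.2 : ℕ) : ℝ) + g' z.2) / 3
  have hS : ∀ a : I × M0, h (a.1, X.S a.2) = (e * posX a + e' * posY a) / 3 := by
    intro a
    simp only [h, hg'S, L, posX, posY]
    ring
  rw [← hS a, ← hS b]
  apply le_tensorDist
  · rintro ⟨m, x⟩ ⟨n, y⟩ ⟨p, q, hp, hq, hE⟩
    dsimp only at hp hq hE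
    rw [hp, hq, hS (m, p), hS (n, q), hE.pos.1, hE.pos.2]
  · intro m x y
    have : h (m, x) - h (m, y) = (1 / 3) * (g' x - g' y) := by simp only [h]; ring
    rw [this, abs_mul, abs_of_pos (by norm_num : (0 : ℝ) < 1 / 3)]
    exact mul_le_mul_of_nonneg_left (hg' x y) (by norm_num)
  · have bound : ∀ z, |h z - c| ≤ 1 := by
      intro z
      have h1 := hg'1 z.2
      have h2 := hg'2 z.2
      obtain ⟨h3, h3'⟩ := coord_le_two z.1.1.1
      obtain ⟨h4, h4'⟩ := coord_le_two z.1.1.2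
      exact linear_bound he he' h3 h3' h4 h4' h1 h2
    intro z w
    have h1 := abs_le.1 (bound z)
    have h2 := abs_le.1 (bound w)
    rw [abs_le]
    constructor <;> linarith

theorem taxi_le_tensorDist (a b : I × M0) :
    (|posX a - posX b| + |posY a - posY b|) / 3 ≤
      tensorDist I X (Tensor.mk I X (a.1, X.S a.2)) (Tensor.mk I X (b.1, X.S b.2)) := by
  have h := fun e e' he he' => abs_le.1 (linear_le_tensorDist (I := I) (X := X)
    (e := e) (e' := e') he he' a b)
  have h1 := h 1 1 (by simp) (by simp)
  have h2 := h 1 (-1) (by simp) (by simp)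
  rcases abs_cases (posX a - posX b) with ⟨k, _⟩ | ⟨k, _⟩ <;>
  rcases abs_cases (posY a - posY b) with ⟨k', _⟩ | ⟨k', _⟩ <;> rw [k, k'] <;> linarith

theorem isClosed_range_S : IsClosed (Set.range X.S) := by
  have hV : ∀ e : ℝ, (e = 0 ∨ e = 1) → IsCompact (X.S '' {p | p.1.1 = e}) := by
    intro e he
    have he' : 0 ≤ e ∧ e ≤ 1 := by rcases he with rfl | rfl <;> norm_num
    let P : Set.Icc (0 : ℝ) 1 → M0 := fun t =>
      ⟨(e, t.1), M0_mk he'.1 he'.2 t.2.1 t.2.2 (by tauto)⟩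
    let f : Set.Icc (0 : ℝ) 1 → X.carrier := fun t => X.S (P t)
    have hf : Isometry f := Isometry.of_dist_eq fun s t => by
      refine (X.sq1_vertical (P s) (P t) he rfl).trans ?_
      rw [abs_sub_comm, Subtype.dist_eq, Real.dist_eq]
    convert isCompact_range hf.continuous using 1
    ext x
    constructor
    · rintro ⟨p, rfl, rfl⟩
      exact ⟨⟨p.1.2, (M0_bounds p).2.2⟩, rfl⟩
    · rintro ⟨t, rfl⟩
      exact ⟨_, rfl, rfl⟩
  have hH : ∀ e : ℝ, (e = 0 ∨ e = 1) → IsCompact (X.S '' {p | p.1.2 = e}) := by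
    intro e he
    have he' : 0 ≤ e ∧ e ≤ 1 := by rcases he with rfl | rfl <;> norm_num
    let P : Set.Icc (0 : ℝ) 1 → M0 := fun t =>
      ⟨(t.1, e), M0_mk t.2.1 t.2.2 he'.1 he'.2 (by tauto)⟩
    let f : Set.Icc (0 : ℝ) 1 → X.carrier := fun t => X.S (P t)
    have hf : Isometry f := Isometry.of_dist_eq fun s t => by
      refine (X.sq1_horizontal (P s) (P t) he rfl).trans ?_
      rw [abs_sub_comm, Subtype.dist_eq, Real.dist_eq]
    convert isCompact_range hf.continuous using 1
    ext x
    constructor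
    · rintro ⟨p, rfl, rfl⟩
      exact ⟨⟨p.1.1, (M0_bounds p).1, (M0_bounds p).2.1⟩, rfl⟩
    · rintro ⟨t, rfl⟩
      exact ⟨_, rfl, rfl⟩
  have hr : Set.range X.S = (X.S '' {p | p.1.1 = 0} ∪ X.S '' {p | p.1.1 = 1}) ∪
      (X.S '' {p | p.1.2 = 0} ∪ X.S '' {p | p.1.2 = 1}) := by
    ext x
    constructor
    · rintro ⟨p, rfl⟩
      rcases M0_sides p with h | h | h | h
      · exact Or.inl (Or.inl ⟨p, h, rfl⟩)
      · exact Or.inl (Or.inr ⟨p, h, rfl⟩)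
      · exact Or.inr (Or.inl ⟨p, h, rfl⟩)
      · exact Or.inr (Or.inr ⟨p, h, rfl⟩)
    · rintro ((⟨p, -, rfl⟩ | ⟨p, -, rfl⟩) | (⟨p, -, rfl⟩ | ⟨p, -, rfl⟩)) <;> exact ⟨p, rfl⟩
  rw [hr]
  exact (((hV 0 (by simp)).union (hV 1 (by simp))).union
    ((hH 0 (by simp)).union (hH 1 (by simp)))).isClosed

theorem eq_of_tensorDist_interior {m n : I} {x y : X.carrier} (hx : x ∉ Set.range X.S)
    (h : tensorDist I X (Tensor.mk I X (m, x)) (Tensor.mk I X (n, y)) = 0) :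
    Tensor.mk I X (m, x) = Tensor.mk I X (n, y) := by
  obtain ⟨δ, hδ, hball⟩ := Metric.isOpen_iff.1 (isClosed_range_S (X := X)).isOpen_compl x hx
  have hd : ∀ p, δ ≤ dist (X.S p) x := by
    intro p
    by_contra hlt
    exact hball (Metric.mem_ball.2 (not_le.1 hlt)) ⟨p, rfl⟩
  have hδ2 : δ ≤ 2 := (hd ⟨(0, 0), M0_mk (by simp) (by simp) (by simp) (by simp) (by simp)⟩).trans
    (X.dist_le_two _ _)
  let φ : I × X.carrier → ℝ := fun z => if z.1 = m then (1 / 3) * min (dist z.2 x) δ else δ / 3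
  have hφS : ∀ k p, φ (k, X.S p) = δ / 3 := by
    intro k p
    simp only [φ, min_eq_right (hd p)]
    split_ifs <;> ring
  have hφ : ∀ z, 0 ≤ φ z ∧ φ z ≤ δ / 3 := by
    intro z
    have h1 : 0 ≤ min (dist z.2 x) δ := le_min dist_nonneg hδ.le
    have h2 : min (dist z.2 x) δ ≤ δ := min_le_right _ _
    simp only [φ]
    split_ifs <;> constructor <;> linarith
  have key := le_tensorDist φ (by
      rintro ⟨k, _⟩ ⟨l, _⟩ ⟨p, q, rfl, rfl, -⟩
      rw [hφS, hφS]) (by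
      intro k z w
      simp only [φ]
      split_ifs
      · rw [← mul_sub, abs_mul, abs_of_pos (by norm_num : (0 : ℝ) < 1 / 3)]
        refine mul_le_mul_of_nonneg_left ?_ (by norm_num)
        refine (abs_min_sub_min_le_max _ _ _ _).trans (max_le ?_ (by simp))
        exact abs_dist_sub_le _ _ _
      · simp) (by
      intro z w
      have := hφ z
      have := hφ w
      rw [abs_le]
      constructor <;> linarith) (m, x) (n, y)
  rw [h] at key
  have h0 : φ (m, x) = 0 := by simp [φ, hδ.le]
  have h1 : φ (n, y) = 0 := by
    rw [h0, zero_sub, abs_neg] at key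
    exact abs_nonpos_iff.1 key
  by_cases hn : n = m
  · subst hn
    have h2 : min (dist y x) δ = 0 := by simpa [φ] using h1
    have h3 : dist y x = 0 := by
      rcases min_choice (dist y x) δ with h | h <;> rw [h] at h2
      · exact h2
      · exact absurd h2 hδ.ne'
    rw [dist_eq_zero.1 h3]
  · simp only [φ, if_neg hn] at h1
    linarith

theorem eq_of_tensorDist_eq_zero [IsIndexSet I] {y z : Tensor I X}
    (h : tensorDist I X y z = 0) : y = z := by
  obtain ⟨⟨m, x⟩, rfl⟩ := y.exists_mk
  obtain ⟨⟨n, w⟩, rfl⟩ := z.exists_mk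
  by_cases hx : x ∈ Set.range X.S
  · by_cases hw : w ∈ Set.range X.S
    · obtain ⟨p, rfl⟩ := hx
      obtain ⟨q, rfl⟩ := hw
      have h1 := taxi_le_tensorDist (I := I) (X := X) (m, p) (n, q)
      rw [h] at h1
      have h2 := abs_nonneg (posX (m, p) - posX (n, q))
      have h3 := abs_nonneg (posY (m, p) - posY (n, q))
      exact mk_eq_of_pos (a := (m, p)) (b := (n, q))
        (sub_eq_zero.1 (abs_eq_zero.1 (by linarith)))
        (sub_eq_zero.1 (abs_eq_zero.1 (by linarith)))
    · rw [tensorDist_comm] at h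
      exact (eq_of_tensorDist_interior hw h).symm
  · exact eq_of_tensorDist_interior hx h

end Metric

/-- `I ⊗ X` is a metric space with the quotient metric. -/
instance (I : Finset (Fin 3 × Fin 3)) [IsIndexSet I] (X : SquaMS.{u}) :
    MetricSpace (Tensor I X) where
  dist := tensorDist I X
  dist_self := tensorDist_self
  dist_comm := tensorDist_comm
  dist_triangle := tensorDist_triangle
  eq_of_dist_eq_zero := eq_of_tensorDist_eq_zero

/-! ## The functor -/

/-- The third of the unit interval that contains `r`. -/
def third (r : ℝ) : Fin 3 := if r ≤ 1 / 3 then 0 else if r ≤ 2 / 3 then 1 else 2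

theorem third_spec {r : ℝ} (h0 : 0 ≤ r) (h1 : r ≤ 1) :
    0 ≤ 3 * r - ((third r : ℕ) : ℝ) ∧ 3 * r - ((third r : ℕ) : ℝ) ≤ 1 := by
  unfold third
  split_ifs <;> norm_num <;> constructor <;> linarith

theorem third_zero : third 0 = 0 := by unfold third; norm_num

theorem third_one : third 1 = 2 := by unfold third; norm_num

/-- The cell that contains the point `p` of the boundary of the unit square. -/
def outerCell (p : M0) : Fin 3 × Fin 3 := (third p.1.1, third p.1.2)

theorem outerCell_ne (p : M0) : outerCell p ≠ (1, 1) := by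
  intro h
  have h1 := (Prod.ext_iff.1 h).1
  have h2 := (Prod.ext_iff.1 h).2
  simp only [outerCell] at h1 h2
  rcases M0_sides p with h | h | h | h
  · rw [h, third_zero] at h1; exact absurd h1 (by decide)
  · rw [h, third_one] at h1; exact absurd h1 (by decide)
  · rw [h, third_zero] at h2; exact absurd h2 (by decide)
  · rw [h, third_one] at h2; exact absurd h2 (by decide)

/-- The point `p`, in the coordinates of the cell that contains it. -/
def outerPoint (p : M0) : M0 :=
  ⟨(3 * p.1.1 - ((third p.1.1 : ℕ) : ℝ), 3 * p.1.2 - ((third p.1.2 : ℕ) : ℝ)), by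
    have hp := M0_bounds p
    have h1 := third_spec hp.1 hp.2.1
    have h2 := third_spec hp.2.2.1 hp.2.2.2
    refine M0_mk h1.1 h1.2 h2.1 h2.2 ?_
    rcases M0_sides p with h | h | h | h
    · left; rw [h, third_zero]; norm_num
    · right; left; rw [h, third_one]; norm_num
    · right; right; left; rw [h, third_zero]; norm_num
    · right; right; right; rw [h, third_one]; norm_num⟩

/-- The map `S` of `I ⊗ X`: each side consists of three copies of the corresponding side of `X`,
for example `S (0, r) = (0, j) ⊗ S_X (0, 3r - j)` if `j / 3 ≤ r ≤ (j + 1) / 3`. -/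
def tensorS (I : Finset (Fin 3 × Fin 3)) [IsIndexSet I] (X : SquaMS.{u}) (p : M0) : Tensor I X :=
  Tensor.mk I X (⟨outerCell p, mem_of_ne (outerCell_ne p)⟩, X.S (outerPoint p))

/-- The definition of `S` does not depend on the choice of the cell. -/
theorem tensorS_eq (I : Finset (Fin 3 × Fin 3)) [IsIndexSet I] (X : SquaMS.{u}) (p : M0)
    (a : I × M0) (hx : posX a = 3 * p.1.1) (hy : posY a = 3 * p.1.2) :
    tensorS I X p = Tensor.mk I X (a.1, X.S a.2) := by
  refine mk_eq_of_pos (a := (⟨outerCell p, mem_of_ne (outerCell_ne p)⟩, outerPoint p)) ?_ ?_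
  · rw [hx]; simp only [posX, outerCell, outerPoint]; ring
  · rw [hy]; simp only [posY, outerCell, outerPoint]; ring

theorem tensorS_sq2 (I : Finset (Fin 3 × Fin 3)) [IsIndexSet I] (X : SquaMS.{u}) (p q : M0) :
    |p.1.1 - q.1.1| + |p.1.2 - q.1.2| ≤ dist (tensorS I X p) (tensorS I X q) := by
  have h := taxi_le_tensorDist (I := I) (X := X)
    (⟨outerCell p, mem_of_ne (outerCell_ne p)⟩, outerPoint p)
    (⟨outerCell q, mem_of_ne (outerCell_ne q)⟩, outerPoint q)
  refine le_trans (le_of_eq ?_) h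
  simp only [posX, posY, outerCell, outerPoint]
  have e : ∀ (i k r t : ℝ), |i + (3 * r - i) - (k + (3 * t - k))| = 3 * |r - t| := by
    intro i k r t
    rw [← abs_of_pos (by norm_num : (0 : ℝ) < 3), ← abs_mul, abs_of_pos (by norm_num : (0 : ℝ) < 3)]
    congr 1; ring
  rw [e, e]; ring

/-- A map on the unit interval that is short on each third is short. -/
theorem short_of_thirds {Y : Type u} [MetricSpace Y] (f : Set.Icc (0 : ℝ) 1 → Y)
    (h : ∀ (i : Fin 3) (s t : Set.Icc (0 : ℝ) 1), ((i : ℕ) : ℝ) ≤ 3 * s.1 →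
      3 * s.1 ≤ ((i : ℕ) : ℝ) + 1 → ((i : ℕ) : ℝ) ≤ 3 * t.1 → 3 * t.1 ≤ ((i : ℕ) : ℝ) + 1 →
      dist (f s) (f t) ≤ |s.1 - t.1|) (s t : Set.Icc (0 : ℝ) 1) :
    dist (f s) (f t) ≤ |s.1 - t.1| := by
  wlog hst : s.1 ≤ t.1 generalizing s t
  · rw [dist_comm, abs_sub_comm]
    exact this t s (le_of_not_ge hst)
  rw [abs_of_nonpos (by linarith)]
  have h' : ∀ (i : Fin 3) (s t : Set.Icc (0 : ℝ) 1), s.1 ≤ t.1 → ((i : ℕ) : ℝ) ≤ 3 * s.1 →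
      3 * t.1 ≤ ((i : ℕ) : ℝ) + 1 → dist (f s) (f t) ≤ t.1 - s.1 := by
    intro i s t hst h1 h2
    have := h i s t h1 (by linarith) (by linarith) h2
    rwa [abs_of_nonpos (by linarith), neg_sub] at this
  obtain ⟨hs0, hs1⟩ := s.2
  obtain ⟨ht0, ht1⟩ := t.2
  obtain ⟨u, hu⟩ : ∃ u : Set.Icc (0 : ℝ) 1, u.1 = 1 / 3 :=
    ⟨⟨1 / 3, by norm_num, by norm_num⟩, rfl⟩
  obtain ⟨v, hv⟩ : ∃ v : Set.Icc (0 : ℝ) 1, v.1 = 2 / 3 :=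
    ⟨⟨2 / 3, by norm_num, by norm_num⟩, rfl⟩
  have z0 : ∀ s t : Set.Icc (0 : ℝ) 1, s.1 ≤ t.1 → 0 ≤ s.1 → t.1 ≤ 1 / 3 →
      dist (f s) (f t) ≤ t.1 - s.1 := fun s t k k' k'' =>
    h' 0 s t k (by simp only [Fin.val_zero, Nat.cast_zero]; linarith)
      (by simp only [Fin.val_zero, Nat.cast_zero]; linarith)
  have z1 : ∀ s t : Set.Icc (0 : ℝ) 1, s.1 ≤ t.1 → 1 / 3 ≤ s.1 → t.1 ≤ 2 / 3 →
      dist (f s) (f t) ≤ t.1 - s.1 := fun s t k k' k'' =>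
    h' 1 s t k (by simp only [Fin.val_one, Nat.cast_one]; linarith)
      (by simp only [Fin.val_one, Nat.cast_one]; linarith)
  have z2 : ∀ s t : Set.Icc (0 : ℝ) 1, s.1 ≤ t.1 → 2 / 3 ≤ s.1 → t.1 ≤ 1 →
      dist (f s) (f t) ≤ t.1 - s.1 := fun s t k k' k'' =>
    h' 2 s t k (by simp only [Fin.val_two, Nat.cast_ofNat]; linarith)
      (by simp only [Fin.val_two, Nat.cast_ofNat]; linarith)
  have tu := dist_triangle (f s) (f u) (f t)
  have tv := dist_triangle (f s) (f v) (f t)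
  have tv' := dist_triangle (f u) (f v) (f t)
  have uv := z1 u v (by rw [hu, hv]; norm_num) hu.ge hv.le
  by_cases h1 : s.1 ≤ 1 / 3
  · have su := z0 s u (by linarith) hs0 hu.le
    by_cases h2 : t.1 ≤ 1 / 3
    · linarith [z0 s t hst hs0 (by linarith)]
    by_cases h3 : t.1 ≤ 2 / 3
    · linarith [z1 u t (by linarith) hu.ge (by linarith)]
    · linarith [z2 v t (by linarith) hv.ge (by linarith)]
  by_cases h4 : s.1 ≤ 2 / 3
  · have sv := z1 s v (by linarith) (by linarith) hv.le
    by_cases h3 : t.1 ≤ 2 / 3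
    · linarith [z1 s t hst (by linarith) (by linarith)]
    · linarith [z2 v t (by linarith) hv.ge (by linarith)]
  · linarith [z2 s t hst (by linarith) (by linarith)]

theorem tensorS_vertical_le (I : Finset (Fin 3 × Fin 3)) [IsIndexSet I] (X : SquaMS.{u})
    (p q : M0) (he : p.1.1 = 0 ∨ p.1.1 = 1) (hpq : p.1.1 = q.1.1) :
    dist (tensorS I X p) (tensorS I X q) ≤ |p.1.2 - q.1.2| := by
  obtain ⟨⟨e, s⟩, hp⟩ := p
  obtain ⟨⟨e', t⟩, hq⟩ := q
  dsimp only at he hpq ⊢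
  subst hpq
  have he' : 0 ≤ e ∧ e ≤ 1 := by rcases he with rfl | rfl <;> norm_num
  have mem : ∀ t : ℝ, 0 ≤ t → t ≤ 1 → (e, t) ∈ M0 := fun t h0 h1 =>
    M0_mk he'.1 he'.2 h0 h1 (by tauto)
  refine short_of_thirds (fun t => tensorS I X ⟨(e, t.1), mem t.1 t.2.1 t.2.2⟩) ?_
    ⟨s, (M0_bounds ⟨_, hp⟩).2.2⟩ ⟨t, (M0_bounds ⟨_, hq⟩).2.2⟩
  intro i s t h1 h2 h3 h4
  have hc : ((third e, i) : Fin 3 × Fin 3) ≠ (1, 1) := by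
    intro h
    have h1 : third e = 1 := (Prod.ext_iff.1 h).1
    rcases he with rfl | rfl
    · rw [third_zero] at h1; exact absurd h1 (by decide)
    · rw [third_one] at h1; exact absurd h1 (by decide)
  have hcorner : 3 * e - ((third e : ℕ) : ℝ) = e := by
    rcases he with rfl | rfl
    · rw [third_zero]; norm_num
    · rw [third_one]; norm_num
  let a : ∀ t : Set.Icc (0 : ℝ) 1, ((i : ℕ) : ℝ) ≤ 3 * t.1 → 3 * t.1 ≤ ((i : ℕ) : ℝ) + 1 → M0 :=
    fun t h1 h2 => ⟨(e, 3 * t.1 - ((i : ℕ) : ℝ)), mem _ (by linarith) (by linarith)⟩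
  rw [tensorS_eq I X ⟨(e, s.1), mem s.1 s.2.1 s.2.2⟩ (⟨(third e, i), mem_of_ne hc⟩, a s h1 h2)
      (by simp only [posX, a]; linarith) (by simp only [posY, a]; ring),
    tensorS_eq I X ⟨(e, t.1), mem t.1 t.2.1 t.2.2⟩ (⟨(third e, i), mem_of_ne hc⟩, a t h3 h4)
      (by simp only [posX, a]; linarith) (by simp only [posY, a]; ring)]
  refine (tensorDist_mk_le _ _).trans ?_
  unfold prodDist
  rw [if_pos rfl, X.sq1_vertical (a s h1 h2) (a t h3 h4) he rfl, abs_sub_comm]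
  simp only [a]
  have e3 : 3 * s.1 - ((i : ℕ) : ℝ) - (3 * t.1 - ((i : ℕ) : ℝ)) = 3 * (s.1 - t.1) := by ring
  rw [e3, abs_mul, abs_of_pos (by norm_num : (0 : ℝ) < 3)]
  linarith

theorem tensorS_horizontal_le (I : Finset (Fin 3 × Fin 3)) [IsIndexSet I] (X : SquaMS.{u})
    (p q : M0) (he : p.1.2 = 0 ∨ p.1.2 = 1) (hpq : p.1.2 = q.1.2) :
    dist (tensorS I X p) (tensorS I X q) ≤ |p.1.1 - q.1.1| := by
  obtain ⟨⟨s, e⟩, hp⟩ := p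
  obtain ⟨⟨t, e'⟩, hq⟩ := q
  dsimp only at he hpq ⊢
  subst hpq
  have he' : 0 ≤ e ∧ e ≤ 1 := by rcases he with rfl | rfl <;> norm_num
  have mem : ∀ t : ℝ, 0 ≤ t → t ≤ 1 → (t, e) ∈ M0 := fun t h0 h1 =>
    M0_mk h0 h1 he'.1 he'.2 (by tauto)
  refine short_of_thirds (fun t => tensorS I X ⟨(t.1, e), mem t.1 t.2.1 t.2.2⟩) ?_
    ⟨s, (M0_bounds ⟨_, hp⟩).1, (M0_bounds ⟨_, hp⟩).2.1⟩
    ⟨t, (M0_bounds ⟨_, hq⟩).1, (M0_bounds ⟨_, hq⟩).2.1⟩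
  intro i s t h1 h2 h3 h4
  have hc : ((i, third e) : Fin 3 × Fin 3) ≠ (1, 1) := by
    intro h
    have h1 : third e = 1 := (Prod.ext_iff.1 h).2
    rcases he with rfl | rfl
    · rw [third_zero] at h1; exact absurd h1 (by decide)
    · rw [third_one] at h1; exact absurd h1 (by decide)
  have hcorner : 3 * e - ((third e : ℕ) : ℝ) = e := by
    rcases he with rfl | rfl
    · rw [third_zero]; norm_num
    · rw [third_one]; norm_num
  let a : ∀ t : Set.Icc (0 : ℝ) 1, ((i : ℕ) : ℝ) ≤ 3 * t.1 → 3 * t.1 ≤ ((i : ℕ) : ℝ) + 1 → M0 :=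
    fun t h1 h2 => ⟨(3 * t.1 - ((i : ℕ) : ℝ), e), mem _ (by linarith) (by linarith)⟩
  rw [tensorS_eq I X ⟨(s.1, e), mem s.1 s.2.1 s.2.2⟩ (⟨(i, third e), mem_of_ne hc⟩, a s h1 h2)
      (by simp only [posX, a]; ring) (by simp only [posY, a]; linarith),
    tensorS_eq I X ⟨(t.1, e), mem t.1 t.2.1 t.2.2⟩ (⟨(i, third e), mem_of_ne hc⟩, a t h3 h4)
      (by simp only [posX, a]; ring) (by simp only [posY, a]; linarith)]
  refine (tensorDist_mk_le _ _).trans ?_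
  unfold prodDist
  rw [if_pos rfl, X.sq1_horizontal (a s h1 h2) (a t h3 h4) he rfl, abs_sub_comm]
  simp only [a]
  have e3 : 3 * s.1 - ((i : ℕ) : ℝ) - (3 * t.1 - ((i : ℕ) : ℝ)) = 3 * (s.1 - t.1) := by ring
  rw [e3, abs_mul, abs_of_pos (by norm_num : (0 : ℝ) < 3)]
  linarith

/-- The square metric space `I ⊗ X`. -/
def tensorObj (I : Finset (Fin 3 × Fin 3)) [IsIndexSet I] (X : SquaMS.{u}) : SquaMS.{u} where
  carrier := Tensor I X
  S := tensorS I X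
  S_injective p q h := by
    have h1 := tensorS_sq2 I X p q
    rw [h, dist_self] at h1
    have h2 := abs_nonneg (p.1.1 - q.1.1)
    have h3 := abs_nonneg (p.1.2 - q.1.2)
    exact Subtype.ext (Prod.ext (sub_eq_zero.1 (abs_eq_zero.1 (by linarith)))
      (sub_eq_zero.1 (abs_eq_zero.1 (by linarith))))
  dist_le_two y z := by
    obtain ⟨a, rfl⟩ := y.exists_mk
    obtain ⟨b, rfl⟩ := z.exists_mk
    exact (tensorDist_mk_le a b).trans (prodDist_le_two a b)
  sq1_vertical p q he hpq := by
    rw [abs_sub_comm]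
    refine le_antisymm (tensorS_vertical_le I X p q he hpq) ?_
    have h := tensorS_sq2 I X p q
    rwa [hpq, sub_self, abs_zero, zero_add] at h
  sq1_horizontal p q he hpq := by
    rw [abs_sub_comm]
    refine le_antisymm (tensorS_horizontal_le I X p q he hpq) ?_
    have h := tensorS_sq2 I X p q
    rwa [hpq, sub_self, abs_zero, add_zero] at h
  sq2 := tensorS_sq2 I X

theorem glue_map {I : Finset (Fin 3 × Fin 3)} {X Y : SquaMS.{u}} (f : SquaMS.Hom X Y)
    (a b : I × X.carrier) (h : glueSetoid I X a b) :
    glueSetoid I Y (a.1, f.toFun a.2) (b.1, f.toFun b.2) := by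
  induction h with
  | rel a b h =>
    obtain ⟨p, q, hp, hq, hE⟩ := h
    refine Relation.EqvGen.rel _ _ ⟨p, q, ?_, ?_, hE⟩
    · rw [hp, f.map_S]
    · rw [hq, f.map_S]
  | refl _ => exact Relation.EqvGen.refl _
  | symm _ _ _ ih => exact Relation.EqvGen.symm _ _ ih
  | trans _ _ _ _ _ ih ih' => exact Relation.EqvGen.trans _ _ _ ih ih'

/-- The map `I ⊗ f`, with `m ⊗ x ↦ m ⊗ f x`. -/
def tensorMap (I : Finset (Fin 3 × Fin 3)) {X Y : SquaMS.{u}} (f : SquaMS.Hom X Y) :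
    Tensor I X → Tensor I Y :=
  Quotient.map (fun a => (a.1, f.toFun a.2)) (glue_map f)

theorem step_map_le {I : Finset (Fin 3 × Fin 3)} {X Y : SquaMS.{u}} (f : SquaMS.Hom X Y)
    (a b : I × X.carrier) :
    step I Y (a.1, f.toFun a.2) (b.1, f.toFun b.2) ≤ step I X a b := by
  by_cases h : glueSetoid I X a b
  · refine le_of_eq_of_le ?_ (step_nonneg a b)
    unfold step
    rw [if_pos (glue_map f a b h)]
  · refine (step_le _ _).trans ?_
    unfold step
    rw [if_neg h]
    unfold prodDist
    dsimp only
    split_ifs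
    · have := f.short a.2 b.2
      linarith
    · exact le_rfl

/-- The morphism `I ⊗ f`. -/
def tensorHom (I : Finset (Fin 3 × Fin 3)) [IsIndexSet I] {X Y : SquaMS.{u}}
    (f : SquaMS.Hom X Y) : SquaMS.Hom (tensorObj I X) (tensorObj I Y) where
  toFun := tensorMap I f
  short y z := by
    refine le_csInf (scores_nonempty (I := I) (X := X) y z) ?_
    rintro s ⟨n, g, h0, hn, rfl⟩
    refine le_trans (tensorDist_le ⟨n, fun k => ((g k).1, f.toFun (g k).2), ?_, ?_, rfl⟩) ?_
    · rw [← h0]; rfl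
    · rw [← hn]; rfl
    · exact Finset.sum_le_sum fun k _ => step_map_le f _ _
  map_S p := by
    change Tensor.mk I Y (_, f.toFun (X.S _)) = Tensor.mk I Y (_, Y.S _)
    rw [f.map_S]

/-- The endofunctor `I ⊗ -` of the category of square metric spaces. -/
def tensorFunctor (I : Finset (Fin 3 × Fin 3)) [IsIndexSet I] : SquaMS.{u} ⥤ SquaMS.{u} where
  obj X := tensorObj I X
  map f := tensorHom I f
  map_id X := SquaMS.Hom.ext' fun y => by
    obtain ⟨a, rfl⟩ := Tensor.exists_mk y
    rfl
  map_comp f g := SquaMS.Hom.ext' fun y => by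
    obtain ⟨a, rfl⟩ := Tensor.exists_mk y
    rfl

/-- The functor `M ⊗ -`. -/
def functorM : SquaMS.{u} ⥤ SquaMS.{u} := tensorFunctor idxM

/-- The functor `N ⊗ -`. -/
def functorN : SquaMS.{u} ⥤ SquaMS.{u} := tensorFunctor idxN

/-! ## The initial chain -/

/-- The iterates `F^k M₀`. -/
def iterObj (F : SquaMS.{u} ⥤ SquaMS.{u}) : ℕ → SquaMS.{u}
  | 0 => boundaryObj
  | k + 1 => F.obj (iterObj F k)

/-- The morphisms `F^k ! : F^k M₀ ⟶ F^(k+1) M₀`. -/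
def iterMap (F : SquaMS.{u} ⥤ SquaMS.{u}) : ∀ k : ℕ, iterObj F k ⟶ iterObj F (k + 1)
  | 0 => boundaryInitial.to (F.obj boundaryObj)
  | k + 1 => F.map (iterMap F k)

/-- The initial chain `M₀ ⟶ F M₀ ⟶ F² M₀ ⟶ ⋯` of an endofunctor `F`. -/
def initialChain (F : SquaMS.{u} ⥤ SquaMS.{u}) : ℕ ⥤ SquaMS.{u} :=
  Functor.ofSequence (iterMap F)

/-- The `k`-th morphism of a cocone on the initial chain. -/
def coconeMap {F : SquaMS.{u} ⥤ SquaMS.{u}} (c : Cocone (initialChain F)) (k : ℕ) :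
    iterObj F k ⟶ c.pt :=
  c.ι.app k

end

end SquareMetric

open SquareMetric

/-!
A morphism out of `I ⊗ X` is a family of `1 / 3`-Lipschitz maps on `X`, one for each cell, which
agree on the glued edges. In a filtered colimit of square metric spaces, computed by identifying
points at limit distance `0`, the universal property holds not only for short maps but for
compatible families of `K`-Lipschitz maps with any constant `K`; the case `K = 1 / 3` shows that
`I ⊗ -` preserves such colimits. Hence `F G` and `G` are both colimits of the initial chain with its
first object dropped, and the argument of Adámek makes the resulting isomorphism `F G ≅ G` an
initial algebra. Only points in the image of `S` are ever glued, and morphisms preserve `S`; so an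
injective `f` gives rise to a left inverse of `I ⊗ f`, and injectivity of the `g k` propagates along
`F (g k) ≫ η = g (k + 1)`.
-/

universe v w

namespace SquareMetric

section Adamek

variable {C : Type*} [Category* C] {F : C ⥤ C} {D : ℕ ⥤ C}

/-- The data which makes `D` an initial chain `0 ⟶ F 0 ⟶ F² 0 ⟶ ⋯` of the endofunctor `F`, up to
isomorphism: `D` starts at an initial object and `F` shifts it by one step. -/
structure IsInitialChain (F : C ⥤ C) (D : ℕ ⥤ C) where
  isInitial : IsInitial (D.obj 0)
  shift : ∀ k, F.obj (D.obj k) ≅ D.obj (k + 1)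
  naturality : ∀ k, F.map (D.map (homOfLE k.le_succ)) ≫ (shift (k + 1)).hom =
    (shift k).hom ≫ D.map (homOfLE (k + 1).le_succ)

/-- The successor functor on `ℕ`; precomposing with it drops the first object of a chain. -/
def natSucc : ℕ ⥤ ℕ :=
  (monotone_id.add_const 1).functor

instance final_natSucc : natSucc.Final :=
  (monotone_id.add_const 1).final_functor_iff.2 fun k => ⟨k, k.le_succ⟩

namespace IsInitialChain

/-- The isomorphisms `shift` as an isomorphism of chains. -/
def shiftNatIso (h : IsInitialChain F D) : D ⋙ F ≅ natSucc ⋙ D :=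
  NatIso.ofComponents h.shift fun f =>
    (NatTrans.ofSequence (F := D ⋙ F) (G := natSucc ⋙ D) (fun k => (h.shift k).hom)
      h.naturality).naturality f

variable (h : IsInitialChain F D) (B : Endofunctor.Algebra F)

/-- The legs of the cocone which an `F`-algebra induces on an initial chain. -/
def algebraLeg : ∀ k, D.obj k ⟶ B.a
  | 0 => h.isInitial.to B.a
  | k + 1 => (h.shift k).inv ≫ F.map (algebraLeg k) ≫ B.str

theorem map_succ_comp_algebraLeg (k : ℕ) :
    D.map (homOfLE k.le_succ) ≫ h.algebraLeg B (k + 1) = h.algebraLeg B k := by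
  induction k with
  | zero => exact h.isInitial.hom_ext _ _
  | succ k ih =>
    have hk := h.naturality k
    rw [← Iso.inv_comp_eq, ← Category.assoc, ← Iso.eq_comp_inv] at hk
    rw [algebraLeg, ← reassoc_of% hk, ← F.map_comp_assoc, ih, algebraLeg]

/-- The cocone which an `F`-algebra induces on an initial chain. -/
def algebraCocone : Cocone D where
  pt := B.a
  ι := NatTrans.ofSequence (h.algebraLeg B) fun k =>
    (h.map_succ_comp_algebraLeg B k).trans (Category.comp_id _).symm

variable {c : Cocone D} (hc : IsColimit c) [PreservesColimit D F]

/-- The structure isomorphism `F G ≅ G` on a colimit `G` of an initial chain: both objects are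
colimits of the shifted chain. -/
noncomputable def strIso : F.obj c.pt ≅ c.pt :=
  IsColimit.coconePointsIsoOfNatIso (t := c.whisker natSucc) (isColimitOfPreserves F hc)
    ((Functor.Final.isColimitWhiskerEquiv natSucc c).symm hc) h.shiftNatIso

theorem map_ι_comp_strIso_hom (k : ℕ) :
    F.map (c.ι.app k) ≫ (h.strIso hc).hom = (h.shift k).hom ≫ c.ι.app (k + 1) :=
  IsColimit.comp_coconePointsIsoOfNatIso_hom (isColimitOfPreserves F hc) _ h.shiftNatIso k

theorem eq_strIso_hom_iff {η : F.obj c.pt ⟶ c.pt} :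
    η = (h.strIso hc).hom ↔
      ∀ k, F.map (c.ι.app k) ≫ η = (h.shift k).hom ≫ c.ι.app (k + 1) := by
  refine ⟨?_, fun hη => (isColimitOfPreserves F hc).hom_ext fun k => ?_⟩
  · rintro rfl
    exact h.map_ι_comp_strIso_hom hc
  · exact (hη k).trans (h.map_ι_comp_strIso_hom hc k).symm

theorem map_comp_str_eq_iff {f : c.pt ⟶ B.a} :
    F.map f ≫ B.str = (h.strIso hc).hom ≫ f ↔ ∀ k, c.ι.app k ≫ f = h.algebraLeg B k := by
  have hleg (k : ℕ) : c.ι.app (k + 1) ≫ f =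
      (h.shift k).inv ≫ F.map (c.ι.app k) ≫ (h.strIso hc).hom ≫ f := by
    rw [reassoc_of% h.map_ι_comp_strIso_hom hc, Iso.inv_hom_id_assoc]
  refine ⟨fun hf k => ?_, fun hf => (isColimitOfPreserves F hc).hom_ext fun k => ?_⟩
  · induction k with
    | zero => exact h.isInitial.hom_ext _ _
    | succ k ih => rw [hleg, ← hf, ← F.map_comp_assoc, ih, algebraLeg]
  · rw [← cancel_epi (h.shift k).inv]
    refine Eq.trans ?_ (hleg k)
    rw [hf, algebraLeg, ← hf k, F.map_comp_assoc]
    rfl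

/-- The initial algebra theorem of Adámek. -/
noncomputable def isInitialAlgebra :
    IsInitial (Endofunctor.Algebra.mk c.pt (h.strIso hc).hom) :=
  IsInitial.ofUniqueHom
    (fun B => ⟨hc.desc (h.algebraCocone B),
      (h.map_comp_str_eq_iff B hc).2 (hc.fac (h.algebraCocone B))⟩)
    fun B g => Endofunctor.Algebra.Hom.ext
      (hc.uniq (h.algebraCocone B) g.f ((h.map_comp_str_eq_iff B hc).1 g.h))

end IsInitialChain

end Adamek

section UnderlyingMap

variable {X Y Z : SquaMS.{u}}

theorem SquaMS.map_id (x : X.carrier) : SquaMS.map (𝟙 X) x = x :=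
  rfl

theorem SquaMS.map_comp (f : X ⟶ Y) (g : Y ⟶ Z) (x : X.carrier) :
    SquaMS.map (f ≫ g) x = SquaMS.map g (SquaMS.map f x) :=
  rfl

theorem SquaMS.map_S (f : X ⟶ Y) (p : M0) : SquaMS.map f (X.S p) = Y.S p :=
  SquaMS.Hom.map_S f p

theorem SquaMS.hom_ext {f g : X ⟶ Y} (h : ∀ x, SquaMS.map f x = SquaMS.map g x) : f = g :=
  SquaMS.Hom.ext' h

theorem SquaMS.lipschitzWith_map (f : X ⟶ Y) : LipschitzWith 1 (SquaMS.map f) :=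
  LipschitzWith.mk_one (SquaMS.Hom.short f)

theorem SquaMS.map_inv_map_hom (e : X ≅ Y) (x : X.carrier) :
    SquaMS.map e.inv (SquaMS.map e.hom x) = x := by
  rw [← map_comp, e.hom_inv_id, map_id]

theorem SquaMS.isometry_map_hom (e : X ≅ Y) : Isometry (SquaMS.map e.hom) := by
  refine Isometry.of_dist_eq fun x y => le_antisymm (SquaMS.Hom.short e.hom x y) ?_
  calc dist x y
      = dist (SquaMS.map e.inv (SquaMS.map e.hom x)) (SquaMS.map e.inv (SquaMS.map e.hom y)) := by
        rw [map_inv_map_hom, map_inv_map_hom]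
    _ ≤ dist (SquaMS.map e.hom x) (SquaMS.map e.hom y) := SquaMS.Hom.short e.inv _ _

end UnderlyingMap

section FilteredColimit

variable {J : Type w} [Category.{v} J] {A : J ⥤ SquaMS.{max w u}}

theorem SquaMS.map_map_ι (c : Cocone A) {j k : J} (f : j ⟶ k) (x : (A.obj j).carrier) :
    SquaMS.map (c.ι.app k) (SquaMS.map (A.map f) x) = SquaMS.map (c.ι.app j) x := by
  rw [← SquaMS.map_comp, c.w]

/-- A point of one of the spaces of a diagram. -/
structure DiagramPoint (A : J ⥤ SquaMS.{max w u}) : Type max w u where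
  stage : J
  pt : (A.obj stage).carrier

/-- The distance of two points of a filtered diagram in the limit: the infimum (equivalently, since
the transition maps are short, the limit) of the distances of their images at common later
stages. -/
noncomputable def limitDist (a b : DiagramPoint A) : ℝ :=
  ⨅ s : (l : J) × (a.stage ⟶ l) × (b.stage ⟶ l),
    dist (SquaMS.map (A.map s.2.1) a.pt) (SquaMS.map (A.map s.2.2) b.pt)

theorem limitDist_le {a b : DiagramPoint A} {l : J} (f : a.stage ⟶ l) (g : b.stage ⟶ l) :
    limitDist a b ≤ dist (SquaMS.map (A.map f) a.pt) (SquaMS.map (A.map g) b.pt) :=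
  ciInf_le ⟨0, Set.forall_mem_range.2 fun _ => dist_nonneg⟩
    (⟨l, f, g⟩ : (l : J) × (a.stage ⟶ l) × (b.stage ⟶ l))

theorem limitDist_self (a : DiagramPoint A) : limitDist a a = 0 :=
  le_antisymm ((limitDist_le (𝟙 _) (𝟙 _)).trans_eq (dist_self _))
    (Real.iInf_nonneg fun _ => dist_nonneg)

theorem limitDist_mk_le {j : J} (x y : (A.obj j).carrier) :
    limitDist (A := A) ⟨j, x⟩ ⟨j, y⟩ ≤ dist x y :=
  (limitDist_le (𝟙 j) (𝟙 j)).trans_eq (by simp only [A.map_id, SquaMS.map_id])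

variable [IsFiltered J]

instance nonempty_upperBounds (j k : J) : Nonempty ((l : J) × (j ⟶ l) × (k ⟶ l)) :=
  ⟨⟨_, IsFiltered.leftToMax _ _, IsFiltered.rightToMax _ _⟩⟩

theorem exists_dist_lt_of_limitDist_lt {a b : DiagramPoint A} {r : ℝ} (h : limitDist a b < r) :
    ∃ (l : J) (f : a.stage ⟶ l) (g : b.stage ⟶ l),
      dist (SquaMS.map (A.map f) a.pt) (SquaMS.map (A.map g) b.pt) < r :=
  let ⟨⟨l, f, g⟩, hr⟩ := exists_lt_of_ciInf_lt h
  ⟨l, f, g, hr⟩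

theorem limitDist_comm (a b : DiagramPoint A) : limitDist a b = limitDist b a := by
  have h (a b : DiagramPoint A) : limitDist a b ≤ limitDist b a :=
    le_ciInf fun s => (limitDist_le s.2.2 s.2.1).trans_eq (dist_comm _ _)
  exact le_antisymm (h a b) (h b a)

theorem limitDist_triangle (a b c : DiagramPoint A) :
    limitDist a c ≤ limitDist a b + limitDist b c := by
  refine le_of_forall_pos_lt_add fun ε hε => ?_
  obtain ⟨l, f, g, hab⟩ :=
    exists_dist_lt_of_limitDist_lt (lt_add_of_pos_right (limitDist a b) (half_pos hε))
  obtain ⟨l', g', h, hbc⟩ :=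
    exists_dist_lt_of_limitDist_lt (lt_add_of_pos_right (limitDist b c) (half_pos hε))
  obtain ⟨m, i, i', hm⟩ := IsFiltered.span g g'
  calc limitDist a c
      ≤ dist (SquaMS.map (A.map (f ≫ i)) a.pt) (SquaMS.map (A.map (h ≫ i')) c.pt) :=
        limitDist_le _ _
    _ ≤ dist (SquaMS.map (A.map (f ≫ i)) a.pt) (SquaMS.map (A.map (g ≫ i)) b.pt) +
        dist (SquaMS.map (A.map (g' ≫ i')) b.pt) (SquaMS.map (A.map (h ≫ i')) c.pt) := by
        rw [hm]
        exact dist_triangle _ _ _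
    _ ≤ dist (SquaMS.map (A.map f) a.pt) (SquaMS.map (A.map g) b.pt) +
        dist (SquaMS.map (A.map g') b.pt) (SquaMS.map (A.map h) c.pt) := by
        simp only [A.map_comp, SquaMS.map_comp]
        exact add_le_add (SquaMS.Hom.short _ _ _) (SquaMS.Hom.short _ _ _)
    _ < limitDist a b + limitDist b c + ε := by linarith

noncomputable instance : PseudoMetricSpace (DiagramPoint A) where
  dist := limitDist
  dist_self := limitDist_self
  dist_comm := limitDist_comm
  dist_triangle := limitDist_triangle

theorem inseparable_map {j k : J} (f : j ⟶ k) (x : (A.obj j).carrier) :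
    Inseparable (⟨k, SquaMS.map (A.map f) x⟩ : DiagramPoint A) ⟨j, x⟩ := by
  refine Metric.inseparable_iff.2 (le_antisymm ((limitDist_le (𝟙 k) f).trans_eq ?_) dist_nonneg)
  rw [A.map_id, SquaMS.map_id, dist_self]

theorem inseparable_S (j k : J) (p : M0) :
    Inseparable (⟨j, (A.obj j).S p⟩ : DiagramPoint A) ⟨k, (A.obj k).S p⟩ := by
  have hj := inseparable_map (A := A) (IsFiltered.leftToMax j k) ((A.obj j).S p)
  have hk := inseparable_map (A := A) (IsFiltered.rightToMax j k) ((A.obj k).S p)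
  rw [SquaMS.map_S] at hj hk
  exact hj.symm.trans hk

theorem limitDist_S_eq {p q : M0} {r : ℝ} (j : J)
    (h : ∀ k, dist ((A.obj k).S p) ((A.obj k).S q) = r) :
    limitDist (A := A) ⟨j, (A.obj j).S p⟩ ⟨j, (A.obj j).S q⟩ = r := by
  simp only [limitDist, SquaMS.map_S, h, ciInf_const]

theorem le_limitDist_S (p q : M0) (j : J) :
    |p.1.1 - q.1.1| + |p.1.2 - q.1.2| ≤
      limitDist (A := A) ⟨j, (A.obj j).S p⟩ ⟨j, (A.obj j).S q⟩ :=
  le_ciInf fun s => by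
    simpa only [SquaMS.map_S] using (A.obj s.1).sq2 p q

theorem lipschitzWith_of_compatible {Y : Type*} [PseudoMetricSpace Y] {K : NNReal}
    {t : ∀ j, (A.obj j).carrier → Y}
    (ht : ∀ {j k} (f : j ⟶ k) x, t k (SquaMS.map (A.map f) x) = t j x)
    (hK : ∀ j, LipschitzWith K (t j)) :
    LipschitzWith K fun a : DiagramPoint A => t a.stage a.pt := by
  refine LipschitzWith.of_dist_le_mul fun a b => ?_
  change _ ≤ (K : ℝ) * limitDist a b
  rw [limitDist, Real.mul_iInf_of_nonneg K.coe_nonneg]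
  refine le_ciInf fun s => ?_
  rw [← ht s.2.1, ← ht s.2.2]
  exact (hK s.1).dist_le_mul _ _

/-- The colimit of a filtered diagram: the metric identification of its points with the limit
distance. -/
noncomputable def filteredColimit (A : J ⥤ SquaMS.{max w u}) : SquaMS.{max w u} :=
  let j : J := IsFiltered.nonempty.some
  { carrier := SeparationQuotient (DiagramPoint A)
    S p := SeparationQuotient.mk ⟨j, (A.obj j).S p⟩
    S_injective p q h := by
      have h0 : limitDist (A := A) ⟨j, (A.obj j).S p⟩ ⟨j, (A.obj j).S q⟩ = 0 :=
        Metric.inseparable_iff.1 (SeparationQuotient.mk_eq_mk.1 h)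
      have htaxi := (le_limitDist_S p q j).trans_eq h0
      exact Subtype.ext (Prod.ext
        (sub_eq_zero.1 (abs_nonpos_iff.1 (by linarith [abs_nonneg (p.1.2 - q.1.2)])))
        (sub_eq_zero.1 (abs_nonpos_iff.1 (by linarith [abs_nonneg (p.1.1 - q.1.1)]))))
    dist_le_two := SeparationQuotient.surjective_mk.forall₂.2 fun a b =>
      (limitDist_le (IsFiltered.leftToMax _ _) (IsFiltered.rightToMax _ _)).trans
        (SquaMS.dist_le_two _ _ _)
    sq1_vertical p q he hpq := limitDist_S_eq j fun k => (A.obj k).sq1_vertical p q he hpq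
    sq1_horizontal p q he hpq := limitDist_S_eq j fun k => (A.obj k).sq1_horizontal p q he hpq
    sq2 p q := le_limitDist_S p q j }

/-- The canonical cocone on a filtered diagram. -/
noncomputable def filteredCocone (A : J ⥤ SquaMS.{max w u}) : Cocone A where
  pt := filteredColimit A
  ι :=
    { app j :=
        { toFun x := SeparationQuotient.mk ⟨j, x⟩
          short := limitDist_mk_le
          map_S p := SeparationQuotient.mk_eq_mk.2 (inseparable_S _ _ p) }
      naturality _ _ f := SquaMS.hom_ext fun x =>
        SeparationQuotient.mk_eq_mk.2 (inseparable_map f x) }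

theorem filteredCocone_jointly_surjective (y : (filteredCocone A).pt.carrier) :
    ∃ j x, SquaMS.map ((filteredCocone A).ι.app j) x = y :=
  let ⟨a, ha⟩ := SeparationQuotient.surjective_mk y
  ⟨a.stage, a.pt, ha⟩

theorem exists_lipschitz_desc_filteredCocone {Y : Type*} [MetricSpace Y] {K : NNReal}
    {t : ∀ j, (A.obj j).carrier → Y}
    (ht : ∀ {j k} (f : j ⟶ k) x, t k (SquaMS.map (A.map f) x) = t j x)
    (hK : ∀ j, LipschitzWith K (t j)) :
    ∃ g : (filteredCocone A).pt.carrier → Y, LipschitzWith K g ∧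
      ∀ j x, g (SquaMS.map ((filteredCocone A).ι.app j) x) = t j x := by
  have hlip := lipschitzWith_of_compatible ht hK
  exact ⟨SeparationQuotient.lift _ fun _ _ h => (h.map hlip.continuous).eq,
    SeparationQuotient.surjective_mk.forall₂.2 hlip, fun _ _ => rfl⟩

noncomputable def filteredCoconeIsColimit (A : J ⥤ SquaMS.{max w u}) :
    IsColimit (filteredCocone A) :=
  .ofExistsUnique fun s => by
    obtain ⟨g, hlip, hg⟩ := exists_lipschitz_desc_filteredCocone
      (t := fun j => SquaMS.map (s.ι.app j)) (SquaMS.map_map_ι s)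
      fun j => SquaMS.lipschitzWith_map (s.ι.app j)
    let j : J := IsFiltered.nonempty.some
    refine ⟨⟨g, by simpa using hlip.dist_le_mul, fun p => ?_⟩, fun j => SquaMS.hom_ext (hg j),
      fun f hf => SquaMS.hom_ext fun y => ?_⟩
    · exact (hg j _).trans (SquaMS.map_S (s.ι.app j) p)
    · obtain ⟨j, x, rfl⟩ := filteredCocone_jointly_surjective y
      exact (congrArg (SquaMS.map · x) (hf j)).trans (hg j x).symm

theorem hasColimitsOfShape_of_isFiltered (J : Type w) [Category.{v} J] [IsFiltered J] :
    HasColimitsOfShape J SquaMS.{max w u} where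
  has_colimit A := ⟨⟨⟨filteredCocone A, filteredCoconeIsColimit A⟩⟩⟩

theorem jointly_surjective_of_isColimit {c : Cocone A} (hc : IsColimit c) (y : c.pt.carrier) :
    ∃ j x, SquaMS.map (c.ι.app j) x = y := by
  let e := hc.coconePointUniqueUpToIso (filteredCoconeIsColimit A)
  obtain ⟨j, x, hx⟩ := filteredCocone_jointly_surjective (SquaMS.map e.hom y)
  refine ⟨j, x, ?_⟩
  rw [← SquaMS.map_inv_map_hom e y, ← hx, ← SquaMS.map_comp,
    hc.comp_coconePointUniqueUpToIso_inv (filteredCoconeIsColimit A)]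

theorem exists_lipschitz_desc {c : Cocone A} (hc : IsColimit c) {Y : Type*} [MetricSpace Y]
    {K : NNReal} {t : ∀ j, (A.obj j).carrier → Y}
    (ht : ∀ {j k} (f : j ⟶ k) x, t k (SquaMS.map (A.map f) x) = t j x)
    (hK : ∀ j, LipschitzWith K (t j)) :
    ∃ g : c.pt.carrier → Y, LipschitzWith K g ∧ ∀ j x, g (SquaMS.map (c.ι.app j) x) = t j x := by
  let e := hc.coconePointUniqueUpToIso (filteredCoconeIsColimit A)
  obtain ⟨g, hlip, hg⟩ := exists_lipschitz_desc_filteredCocone ht hK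
  refine ⟨g ∘ SquaMS.map e.hom, mul_one K ▸ hlip.comp (SquaMS.lipschitzWith_map e.hom),
    fun j x => ?_⟩
  rw [Function.comp_apply, ← SquaMS.map_comp,
    hc.comp_coconePointUniqueUpToIso_hom (filteredCoconeIsColimit A), hg]

end FilteredColimit

section TensorMaps

variable {I : Finset (Fin 3 × Fin 3)} {X Y : SquaMS.{u}}

theorem apply_eq_of_glueSetoid {Z : Type*} {h : I × X.carrier → Z}
    (hglue : ∀ a b, Glue I X a b → h a = h b) {a b : I × X.carrier} (hab : glueSetoid I X a b) :
    h a = h b :=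
  Setoid.eqvGen_le (s := Setoid.ker h) hglue hab

theorem dist_apply_le_tensorDist {Z : Type*} [PseudoMetricSpace Z] {h : I × X.carrier → Z}
    (hZ : ∀ z z' : Z, dist z z' ≤ 2) (hglue : ∀ a b, Glue I X a b → h a = h b)
    (hlip : ∀ m, LipschitzWith 3⁻¹ fun x => h (m, x)) (a b : I × X.carrier) :
    dist (h a) (h b) ≤ tensorDist I X (Tensor.mk I X a) (Tensor.mk I X b) := by
  have key := le_tensorDist (fun z => dist (h z) (h b))
    (fun z z' hz => by rw [hglue z z' hz])
    (fun m x y => (abs_dist_sub_le _ _ _).trans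
      (((hlip m).dist_le_mul x y).trans_eq (by norm_num)))
    (fun z z' => (abs_dist_sub_le _ _ _).trans (hZ _ _)) a b
  simpa only [dist_self, sub_zero, abs_dist] using key

theorem lipschitzWith_tensorMk [IsIndexSet I] (m : I) :
    LipschitzWith 3⁻¹ fun x : X.carrier => (Tensor.mk I X (m, x) : (tensorObj I X).carrier) :=
  LipschitzWith.of_dist_le_mul fun x y =>
    (tensorDist_mk_le (m, x) (m, y)).trans_eq (by simp [prodDist])

theorem tensorMk_S_eq_of_edge {m n : I} {p q : M0} (h : Edge I (m, p) (n, q)) :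
    Tensor.mk I X (m, X.S p) = Tensor.mk I X (n, X.S q) :=
  glue_of_eqvGen (.rel _ _ h)

variable [IsIndexSet I]

/-- The morphism out of `I ⊗ X` given on each cell by a map `X → Y` contracting by `1 / 3`. -/
def tensorDesc (h : I × X.carrier → Y.carrier)
    (hglue : ∀ a b, Glue I X a b → h a = h b)
    (hlip : ∀ m, LipschitzWith 3⁻¹ fun x => h (m, x))
    (hS : ∀ p, h (⟨outerCell p, mem_of_ne (outerCell_ne p)⟩, X.S (outerPoint p)) = Y.S p) :
    tensorObj I X ⟶ Y where
  toFun := Quotient.lift h fun _ _ => apply_eq_of_glueSetoid hglue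
  short := Quotient.ind₂ (dist_apply_le_tensorDist Y.dist_le_two hglue hlip)
  map_S := hS

theorem tensorFunctor_map_injective (I : Finset (Fin 3 × Fin 3)) [IsIndexSet I] {f : X ⟶ Y}
    (hf : Function.Injective (SquaMS.map f)) :
    Function.Injective (SquaMS.map ((tensorFunctor I).map f)) := by
  have hpair : Function.Injective fun a : I × X.carrier => (a.1, SquaMS.map f a.2) :=
    Function.injective_id.prodMap hf
  intro y z hyz
  obtain ⟨a, rfl⟩ := Tensor.exists_mk y
  obtain ⟨b, rfl⟩ := Tensor.exists_mk z
  -- A left inverse of `I ⊗ f`; its value outside the image of `f` is irrelevant, since no point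
  -- there is glued to anything.
  let r : I × Y.carrier → Tensor I X :=
    Function.extend (fun a => (a.1, SquaMS.map f a.2)) (Tensor.mk I X) fun _ => Tensor.mk I X a
  have hr (a : I × X.carrier) : r (a.1, SquaMS.map f a.2) = Tensor.mk I X a :=
    hpair.extend_apply _ _ a
  have hglue : ∀ a b, Glue I Y a b → r a = r b := by
    rintro ⟨m, _⟩ ⟨n, _⟩ ⟨p, q, rfl, rfl, hpq⟩
    have h := tensorMk_S_eq_of_edge (X := X) hpq
    rwa [← hr, ← hr, SquaMS.map_S, SquaMS.map_S] at h
  rw [← hr, ← hr]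
  exact apply_eq_of_glueSetoid hglue (Tensor.mk_eq.1 hyz)

variable {J : Type w} [Category.{v} J] [IsFiltered J] {A : J ⥤ SquaMS.{max w u}}

theorem exists_tensor_desc {c : Cocone A} (hc : IsColimit c) (s : Cocone (A ⋙ tensorFunctor I)) :
    ∃ g : tensorObj I c.pt ⟶ s.pt, ∀ j, (tensorFunctor I).map (c.ι.app j) ≫ g = s.ι.app j := by
  choose g hlip hg using fun m : I => exists_lipschitz_desc hc
    (t := fun j x => SquaMS.map (s.ι.app j) (Tensor.mk I (A.obj j) (m, x)))
    (fun f x => SquaMS.map_map_ι s f (Tensor.mk I _ (m, x)))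
    (fun j => one_mul (3⁻¹ : NNReal) ▸
      (SquaMS.lipschitzWith_map (s.ι.app j)).comp (lipschitzWith_tensorMk m))
  let j : J := IsFiltered.nonempty.some
  have hS (m : I) (p : M0) : g m (c.pt.S p) =
      SquaMS.map (s.ι.app j) (Tensor.mk I (A.obj j) (m, (A.obj j).S p)) := by
    rw [← hg, SquaMS.map_S]
  refine ⟨tensorDesc (fun a => g a.1 a.2) ?_ hlip fun p => ?_, fun j => SquaMS.hom_ext fun y => ?_⟩
  · rintro ⟨m, _⟩ ⟨n, _⟩ ⟨p, q, rfl, rfl, hpq⟩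
    exact (hS m p).trans ((congrArg _ (tensorMk_S_eq_of_edge hpq)).trans (hS n q).symm)
  · exact (hS _ _).trans (SquaMS.map_S (s.ι.app j) p)
  · obtain ⟨⟨m, x⟩, rfl⟩ := Tensor.exists_mk y
    exact hg m j x

theorem tensor_hom_ext {c : Cocone A} (hc : IsColimit c) {Z : SquaMS.{max w u}}
    {f g : tensorObj I c.pt ⟶ Z}
    (h : ∀ j, (tensorFunctor I).map (c.ι.app j) ≫ f = (tensorFunctor I).map (c.ι.app j) ≫ g) :
    f = g :=
  SquaMS.hom_ext fun y => by
    obtain ⟨⟨m, y⟩, rfl⟩ := Tensor.exists_mk y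
    obtain ⟨j, x, rfl⟩ := jointly_surjective_of_isColimit hc y
    exact congrArg (SquaMS.map · (Tensor.mk I (A.obj j) (m, x))) (h j)

theorem tensorFunctor_preservesColimitsOfShape (J : Type w) [Category.{v} J] [IsFiltered J]
    (I : Finset (Fin 3 × Fin 3)) [IsIndexSet I] :
    PreservesColimitsOfShape J (tensorFunctor.{max w u} I) where
  preservesColimit := ⟨fun hc => ⟨.ofExistsUnique fun s =>
    let ⟨g, hg⟩ := exists_tensor_desc hc s
    ⟨g, hg, fun _ hf => tensor_hom_ext hc fun j => (hf j).trans (hg j).symm⟩⟩⟩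

end TensorMaps

section InitialChain

theorem initialChain_map_succ (F : SquaMS.{u} ⥤ SquaMS.{u}) (k : ℕ) :
    (initialChain F).map (homOfLE k.le_succ) = iterMap F k :=
  Functor.ofSequence_map_homOfLE_succ _ k

/-- `F` shifts `initialChain F` on the nose. -/
noncomputable def initialChainIsInitialChain (F : SquaMS.{u} ⥤ SquaMS.{u}) :
    IsInitialChain F (initialChain F) where
  isInitial := boundaryInitial
  shift k := Iso.refl (iterObj F (k + 1))
  naturality k := by
    rw [initialChain_map_succ, initialChain_map_succ]
    exact (Category.comp_id _).trans (Category.id_comp _).symm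

theorem coconeMap_injective {F : SquaMS.{u} ⥤ SquaMS.{u}} {c : Cocone (initialChain F)}
    (hF : ∀ ⦃X Y : SquaMS.{u}⦄ (f : X ⟶ Y), Function.Injective (SquaMS.map f) →
      Function.Injective (SquaMS.map (F.map f)))
    {η : F.obj c.pt ⟶ c.pt} (hη : ∀ k, F.map (coconeMap c k) ≫ η = coconeMap c (k + 1))
    (hinj : Function.Injective (SquaMS.map η)) (k : ℕ) :
    Function.Injective (SquaMS.map (coconeMap c k)) := by
  induction k with
  | zero =>
    rintro ⟨p⟩ ⟨q⟩ hpq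
    have hS (p : M0) : SquaMS.map (coconeMap c 0) ⟨p⟩ = c.pt.S p :=
      SquaMS.map_S (X := boundaryObj) _ p
    rw [hS, hS] at hpq
    rw [c.pt.S_injective hpq]
  | succ k ih =>
    rw [← hη]
    exact hinj.comp (hF _ ih)

end InitialChain

end SquareMetric

theorem mainTheorem3_general (I : Finset (Fin 3 × Fin 3)) [IsIndexSet I]
    (J : Type w) [Category.{v} J] [IsFiltered J] :
    HasColimitsOfShape J SquaMS.{max w u} ∧
    PreservesColimitsOfShape J (tensorFunctor.{max w u} I) ∧
    ∀ c : Cocone (initialChain (tensorFunctor.{u} I)), IsColimit c →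
      ∃ η : (tensorFunctor.{u} I).obj c.pt ⟶ c.pt,
        (∀ k, (tensorFunctor I).map (coconeMap c k) ≫ η = coconeMap c (k + 1)) ∧
        (∀ a : (tensorFunctor.{u} I).obj c.pt ⟶ c.pt,
          (∀ k, (tensorFunctor I).map (coconeMap c k) ≫ a = coconeMap c (k + 1)) → a = η) ∧
        Nonempty (IsInitial (Endofunctor.Algebra.mk (F := tensorFunctor.{u} I) c.pt η)) ∧
        IsIso η ∧ Isometry (SquaMS.map η) ∧
        ∀ k, Function.Injective (SquaMS.map (coconeMap c k)) := by
  refine ⟨hasColimitsOfShape_of_isFiltered J, tensorFunctor_preservesColimitsOfShape J I,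
    fun c hc => ?_⟩
  have := tensorFunctor_preservesColimitsOfShape.{u} ℕ I
  let h := initialChainIsInitialChain (tensorFunctor.{u} I)
  let e := h.strIso hc
  have heq (a : (tensorFunctor I).obj c.pt ⟶ c.pt) :
      a = e.hom ↔ ∀ k, (tensorFunctor I).map (coconeMap c k) ≫ a = coconeMap c (k + 1) :=
    (h.eq_strIso_hom_iff hc).trans <| forall_congr' fun k => by
      rw [← Category.id_comp (coconeMap c (k + 1))]
      rfl
  have hη := (heq e.hom).1 rfl
  have hiso := SquaMS.isometry_map_hom e
  exact ⟨e.hom, hη, fun a => (heq a).2, ⟨h.isInitialAlgebra hc⟩, inferInstance, hiso,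
    coconeMap_injective (fun _ _ _ => tensorFunctor_map_injective I) hη hiso.injective⟩

theorem mainTheorem3 :
    HasColimitsOfShape ℕ SquaMS.{u} ∧
    PreservesColimitsOfShape ℕ functorM.{u} ∧
    PreservesColimitsOfShape ℕ functorN.{u} ∧
    (∀ c : Cocone (initialChain functorM.{u}), IsColimit c →
      ∃ η : functorM.{u}.obj c.pt ⟶ c.pt,
        (∀ k, functorM.map (coconeMap c k) ≫ η = coconeMap c (k + 1)) ∧
        (∀ a : functorM.{u}.obj c.pt ⟶ c.pt,
          (∀ k, functorM.map (coconeMap c k) ≫ a = coconeMap c (k + 1)) → a = η) ∧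
        Nonempty (IsInitial (Endofunctor.Algebra.mk (F := functorM.{u}) c.pt η)) ∧
        IsIso η ∧ Isometry (SquaMS.map η) ∧
        ∀ k, Function.Injective (SquaMS.map (coconeMap c k))) ∧
    (∀ c : Cocone (initialChain functorN.{u}), IsColimit c →
      ∃ ν : functorN.{u}.obj c.pt ⟶ c.pt,
        (∀ k, functorN.map (coconeMap c k) ≫ ν = coconeMap c (k + 1)) ∧
        (∀ a : functorN.{u}.obj c.pt ⟶ c.pt,
          (∀ k, functorN.map (coconeMap c k) ≫ a = coconeMap c (k + 1)) → a = ν) ∧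
        Nonempty (IsInitial (Endofunctor.Algebra.mk (F := functorN.{u}) c.pt ν)) ∧
        IsIso ν ∧ Isometry (SquaMS.map ν) ∧
        ∀ k, Function.Injective (SquaMS.map (coconeMap c k))) := by
  obtain ⟨hcolim, hM, chainM⟩ := mainTheorem3_general idxM ℕ
  obtain ⟨-, hN, chainN⟩ := mainTheorem3_general idxN ℕ
  exact ⟨hcolim, hM, hN, chainM, chainN⟩
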